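/- Let $d\in\mathbb N$, $T\in(0,+\infty]$, and let $b\colon(0,T)\times\mathbb R^d\to\mathbb R^d$ be a measurable vector field with $$b\in L^1((0,T);BV(\mathbb R^d;\mathbb R^d)),\qquad \operatorname{div} b\in L^1((0,T);L^\infty(\mathbb R^d)).$$ That is, $b_t=b(t,\cdot)\in BV(\mathbb R^d;\mathbb R^d)$ for a.e. $t$ with $\int_0^T\big(\|b_t\|_{L^1(\mathbb R^d)}+|Db_t|(\mathbb R^d)\big)\,dt<\infty$, and the distributional divergence of $b_t$ is a bounded function for a.e. $t$ with $\int_0^T\|\operatorname{div}b_t\|_{L^\infty(\mathbb R^d)}\,dt<\infty$. Here $|Db_t|$ is the total variation of the matrix-valued measure $Db_t$, and $|D^sb_t|$ is its singular part with respect to the Lebesgue measure $\mathscr L^d$. For a nonnegative Borel measure $\mu$ on $\mathbb R^d$ let $$\mathsf M\mu(x)=\sup_{r>0}\frac{\mu(B(x,r))}{\mathscr L^d(B(x,r))},$$ and for an open ball $B\subset\mathbb R^d$ and $\delta\in(0,1)$ let $$\mathcal Q(B;\delta)=|\log\delta|^{-1}\int_0^T\!\!\int_B\min\{\delta^{-1},\mathsf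 M|Db_t|(x)\}\,dx\,dt .$$ We say that $b$ has the decay property if $\limsup_{\delta\to0^+}\mathcal Q(B;\delta)=0$ for all balls $B\subset\mathbb R^d$. Then there is a constant $C>0$ depending only on $d$ (in particular not on $T$, $b$ or $B$) such that, for all balls $B\subset\mathbb R^d$, $$\int_0^T|D^sb_t|(B)\,dt\le C\liminf_{\delta\to0^+}\mathcal Q(B;\delta),\qquad \liminf_{\delta\to0^+}\mathcal Q(B;\delta)\le\limsup_{\delta\to0^+}\mathcal Q(B;\delta),$$ and, if $T<+\infty$, $$\limsup_{\delta\to0^+}\mathcal Q(B;\delta)\le C\int_0^T|D^sb_t|(\overline B)\,dt .$$ In particular, if $b$ has the decay property, then $b\in L^1((0,T);W^{1,1}_{\rm loc}(\mathbb R^d;\mathbb R^d))$; and, if $T<+\infty$, then $b$ has the decay property if and only if $b\in L^1((0,T);W^{1,1}_{\rm loc}(\mathbb R^d;\mathbb R^d))$. Here $b\in L^1((0,T);W^{1,1}_{\rm loc})$ means that for a.e. $t$ the field $b_t$ has a locally integrable weak gradient $\nabla b_t$, measurable in $(t,x)$, and $\int_0^T\int_B(|b_t|+|\nabla b_t|)\,dx\,dt<\infty$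 for every ball $B$. -/

import Mathlib

open MeasureTheory Set Filter Topology
open scoped ENNReal NNReal

/-- Euclidean space `ℝᵈ`. -/
abbrev Eucl (d : ℕ) : Type := EuclideanSpace ℝ (Fin d)

/-- The space of `d × d` matrices with the Euclidean (Frobenius) norm. -/
abbrev EuclMat (d : ℕ) : Type := EuclideanSpace ℝ (Fin d × Fin d)

/-- Test functions: smooth and compactly supported. -/
def IsTestFun {d : ℕ} (φ : Eucl d → ℝ) : Prop :=
  ContDiff ℝ (⊤ : ℕ∞) φ ∧ HasCompactSupport φ

/-- The partial derivative `∂ⱼ φ`. -/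
noncomputable def partialDeriv {d : ℕ} (j : Fin d) (φ : Eucl d → ℝ) (x : Eucl d) : ℝ :=
  fderiv ℝ φ x (EuclideanSpace.single j 1)

/-- The matrix-valued measure `D`, of finite total variation, is the distributional derivative
of the vector field `f`: `∫ fᵢ ∂ⱼφ dx = - ∫ φ dDᵢⱼ` for all test functions `φ` and all `i, j`. -/
def IsDerivMeasure {d : ℕ} (f : Eucl d → Eucl d) (D : VectorMeasure (Eucl d) (EuclMat d)) : Prop :=
  D.variation univ < ∞ ∧
    ∀ φ : Eucl d → ℝ, IsTestFun φ → ∀ i j : Fin d,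
      ∫ x, f x i * partialDeriv j φ x = -(∫ᵛ x, φ x ∂•D) (i, j)

/-- `f ∈ BV(ℝᵈ; ℝᵈ)`: `f` is integrable and its distributional derivative is a finite
matrix-valued measure. -/
def MemBV {d : ℕ} (f : Eucl d → Eucl d) : Prop :=
  Integrable f ∧ ∃ D : VectorMeasure (Eucl d) (EuclMat d), IsDerivMeasure f D

open Classical in
/-- The distributional derivative `D f` of a function `f` whose derivative is a finite
matrix-valued measure (which is then unique); zero by convention otherwise. -/
noncomputable def derivMeasure {d : ℕ} (f : Eucl d → Eucl d) : VectorMeasure (Eucl d) (EuclMat d) :=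
  if h : ∃ D : VectorMeasure (Eucl d) (EuclMat d), IsDerivMeasure f D then h.choose else 0

/-- The total variation measure `|D f|`. -/
noncomputable def derivVar {d : ℕ} (f : Eucl d → Eucl d) : Measure (Eucl d) :=
  (derivMeasure f).variation

/-- The measure `|Dˢ f|`, the singular part of `|D f|` with respect to the Lebesgue measure.
It is the total variation of the singular part `Dˢ f` of `D f`. -/
noncomputable def derivVarSing {d : ℕ} (f : Eucl d → Eucl d) : Measure (Eucl d) :=
  (derivVar f).singularPart volume

/-- The Hardy–Littlewood maximal function of a nonnegative measure. -/
noncomputable def maximalFun {d : ℕ} (μ : Measure (Eucl d)) (x : Eucl d) : ℝ≥0∞ :=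
  ⨆ (r : ℝ) (_ : 0 < r), μ (Metric.ball x r) / volume (Metric.ball x r)

/-- The time interval `(0, T)`, where `T ∈ (0, ∞]`. -/
def timeInterval (T : ℝ≥0∞) : Set ℝ :=
  {t | 0 < t ∧ ENNReal.ofReal t < T}

/-- `b ∈ L¹((0,T); BV(ℝᵈ; ℝᵈ))`: `b` is measurable in `(t, x)`, `b_t ∈ BV` for a.e. `t`, and
`∫₀ᵀ (‖b_t‖_{L¹} + |D b_t|(ℝᵈ)) dt < ∞`. -/
def MemL1BV {d : ℕ} (T : ℝ≥0∞) (b : ℝ → Eucl d → Eucl d) : Prop :=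
  AEStronglyMeasurable (fun p : ℝ × Eucl d => b p.1 p.2)
      ((volume.restrict (timeInterval T)).prod volume) ∧
    (∀ᵐ t ∂(volume.restrict (timeInterval T)), MemBV (b t)) ∧
    ∫⁻ t in timeInterval T, (eLpNorm (b t) 1 volume + derivVar (b t) univ) < ∞

/-- `div b ∈ L¹((0,T); L^∞(ℝᵈ))`: for a.e. `t` the distributional divergence of `b_t` is a
function `g_t`, measurable in `(t, x)`, with `∫₀ᵀ ‖g_t‖_{L^∞} dt < ∞`. -/
def DivMemL1Linfty {d : ℕ} (T : ℝ≥0∞) (b : ℝ → Eucl d → Eucl d) : Prop :=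
  ∃ g : ℝ → Eucl d → ℝ,
    AEStronglyMeasurable (fun p : ℝ × Eucl d => g p.1 p.2)
      ((volume.restrict (timeInterval T)).prod volume) ∧
    (∀ᵐ t ∂(volume.restrict (timeInterval T)), ∀ φ : Eucl d → ℝ, IsTestFun φ →
      ∫ x, fderiv ℝ φ x (b t x) = -∫ x, φ x * g t x) ∧
    ∫⁻ t in timeInterval T, eLpNorm (g t) ∞ volume < ∞

/-- `G` is the weak gradient of `f`, both locally integrable, so that `f ∈ W^{1,1}_loc`. -/
def IsWeakGrad {d : ℕ} (f : Eucl d → Eucl d) (G : Eucl d → EuclMat d) : Prop :=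
  LocallyIntegrable f ∧ LocallyIntegrable G ∧
    ∀ φ : Eucl d → ℝ, IsTestFun φ → ∀ i j : Fin d,
      ∫ x, f x i * partialDeriv j φ x = -∫ x, φ x * G x (i, j)

/-- `b ∈ L¹((0,T); W^{1,1}_loc(ℝᵈ; ℝᵈ))`: for a.e. `t` the field `b_t` has a weak gradient `G_t`,
measurable in `(t, x)`, and `∫₀ᵀ ‖b_t‖_{W^{1,1}(B)} dt < ∞` for all balls `B`. -/
def MemL1W11loc {d : ℕ} (T : ℝ≥0∞) (b : ℝ → Eucl d → Eucl d) : Prop :=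
  AEStronglyMeasurable (fun p : ℝ × Eucl d => b p.1 p.2)
      ((volume.restrict (timeInterval T)).prod volume) ∧
    ∃ G : ℝ → Eucl d → EuclMat d,
      AEStronglyMeasurable (fun p : ℝ × Eucl d => G p.1 p.2)
        ((volume.restrict (timeInterval T)).prod volume) ∧
      (∀ᵐ t ∂(volume.restrict (timeInterval T)), IsWeakGrad (b t) (G t)) ∧
      ∀ (x₀ : Eucl d) (r : ℝ), 0 < r →
        ∫⁻ t in timeInterval T, ∫⁻ x in Metric.ball x₀ r, (‖b t x‖ₑ + ‖G t x‖ₑ) < ∞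

/-- `Q(B; δ) = |log δ|⁻¹ ∫₀ᵀ ∫_B min {δ⁻¹, M|D b_t|(x)} dx dt`. -/
noncomputable def decayQ {d : ℕ} (T : ℝ≥0∞) (b : ℝ → Eucl d → Eucl d) (B : Set (Eucl d))
    (δ : ℝ) : ℝ≥0∞ :=
  (ENNReal.ofReal |Real.log δ|)⁻¹ *
    ∫⁻ t in timeInterval T, ∫⁻ x in B, min (ENNReal.ofReal δ⁻¹) (maximalFun (derivVar (b t)) x)

/-- The decay property: `limsup_{δ → 0⁺} Q(B; δ) = 0` for all balls `B`. -/
def DecayProperty {d : ℕ} (T : ℝ≥0∞) (b : ℝ → Eucl d → Eucl d) : Prop :=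
  ∀ (x₀ : Eucl d) (r : ℝ), 0 < r →
    limsup (fun δ => decayQ T b (Metric.ball x₀ r) δ) (𝓝[>] (0 : ℝ)) = 0

/-! ### Weak type estimate for the maximal function of a measure, and its reverse. -/

section MaximalFunction

variable {d : ℕ}

/-! Everything is decided on a single time slice, with `μ = |D b_t|` a finite measure. By the
layer-cake formula the truncated integral over `B` is the integral over `0 < s < δ⁻¹` of the volume
of `B ∩ {M μ > s}`. If that volume behaves like `c / s` for large `s`, the integral grows like `c
|log δ|`, so dividing by `|log δ|` reads off `c`. The claim is that `c` is comparable to the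
singular mass of `μ` in `B`.

Upper bound (`limsup_truncated_le`): the weak (1,1) inequality gives `c ≤ 4 ^ d * μ univ`. Any part
of `μ` whose maximal function is bounded on `B` disappears after division by `|log δ|`. This
discards the singular part away from `B` and the absolutely continuous part with density at most
`n`; what remains has mass tending to the singular mass of `closure B`.

Lower bound (`singularPart_ball_le_liminf_truncated`): the singular part has infinite density at
almost all of its points, so a Vitali selection gives a reverse weak type inequality
(`measure_le_mul_volume_lt_maximalFun`) at all large levels `s`.

Integration in time uses Fatou's lemma for the lower bound. The upper bound uses reverse Fatou, with
majorant `volume B + 4 ^ d * |D b_t| univ`, integrable when `T < ∞`. Both need `t ↦ |D b_t|` to be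
measurable (`measurable_variation`, `measurable_derivVar`). Under the decay property the singular
parts vanish for a.e. `t`, and a jointly measurable gradient is recovered as a limit of
mollifications (`exists_measurable_weakGrad`). Conversely, a weak gradient forces the singular part
to vanish. -/

lemma maximalFun_mono {μ ν : Measure (Eucl d)} (h : μ ≤ ν) (x : Eucl d) :
    maximalFun μ x ≤ maximalFun ν x :=
  iSup₂_mono fun _ _ => ENNReal.div_le_div_right (h _) _

lemma le_maximalFun (μ : Measure (Eucl d)) (x : Eucl d) {r : ℝ} (hr : 0 < r) :
    μ (Metric.ball x r) / volume (Metric.ball x r) ≤ maximalFun μ x :=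
  le_iSup₂ (f := fun (r : ℝ) (_ : 0 < r) => μ (Metric.ball x r) / volume (Metric.ball x r)) r hr

lemma maximalFun_add_le (μ ν : Measure (Eucl d)) (x : Eucl d) :
    maximalFun (μ + ν) x ≤ maximalFun μ x + maximalFun ν x := by
  refine iSup₂_le fun r hr => ?_
  rw [Measure.add_apply, ENNReal.add_div]
  exact add_le_add (le_maximalFun μ x hr) (le_maximalFun ν x hr)

lemma volume_ball_pos (x : Eucl d) {r : ℝ} (hr : 0 < r) : volume (Metric.ball x r) ≠ 0 :=
  (Metric.measure_ball_pos volume x hr).ne'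

lemma volume_ball_ne_top (x : Eucl d) (r : ℝ) : volume (Metric.ball x r) ≠ ∞ :=
  measure_ball_lt_top.ne

lemma volume_ball_mul (x : Eucl d) {s : ℝ} (hs : 0 < s) (r : ℝ) :
    volume (Metric.ball x (s * r)) = ENNReal.ofReal s ^ d * volume (Metric.ball x r) := by
  rw [Measure.addHaar_ball_mul_of_pos volume x hs r, ← Measure.addHaar_ball_center volume x r,
    finrank_euclideanSpace_fin, ENNReal.ofReal_pow hs.le]

lemma lt_maximalFun_iff (μ : Measure (Eucl d)) (x : Eucl d) (l : ℝ≥0∞) :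
    l < maximalFun μ x ↔
      ∃ r : ℝ, 0 < r ∧ l * volume (Metric.ball x r) < μ (Metric.ball x r) := by
  simp only [maximalFun, lt_iSup_iff, exists_prop]
  refine exists_congr fun r => and_congr_right fun hr => ?_
  rw [ENNReal.lt_div_iff_mul_lt (Or.inl (volume_ball_pos x hr))
    (Or.inl (volume_ball_ne_top x r))]

/-- Vitali's covering lemma: disjoint balls of the family, enlarged by the factor 4, cover `A`. The
bound `R` on the radii is needed for the selection but does not enter the estimate. -/
lemma mul_volume_le_of_forall_exists_ball (μ : Measure (Eucl d)) (l : ℝ≥0∞) (R : ℝ)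
    (A : Set (Eucl d))
    (hA : ∀ x ∈ A, ∃ r : ℝ, 0 < r ∧ r ≤ R ∧
      l * volume (Metric.ball x r) ≤ μ (Metric.ball x r)) :
    l * volume A ≤ 4 ^ d * μ univ := by
  choose! r hr0 hrR hr using hA
  obtain ⟨u, huA, hdisj, hcov⟩ := Vitali.exists_disjoint_subfamily_covering_enlargement_ball
    A id r R hrR 4 (by norm_num)
  simp only [id] at hdisj hcov
  have hcount : u.Countable := hdisj.countable_of_isOpen (fun _ _ => Metric.isOpen_ball)
    fun x hx => Metric.nonempty_ball.2 (hr0 x (huA hx))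
  have hsub : A ⊆ ⋃ x ∈ u, Metric.ball x (4 * r x) := fun x hx => by
    obtain ⟨y, hy, hxy⟩ := hcov x hx
    exact mem_iUnion₂.2 ⟨y, hy, hxy (Metric.mem_ball_self (hr0 x hx))⟩
  have := hcount.to_subtype
  calc l * volume A
      ≤ l * ∑' x : u, volume (Metric.ball (x : Eucl d) (4 * r x)) := by
        gcongr
        exact (measure_mono hsub).trans (measure_biUnion_le volume hcount _)
    _ = 4 ^ d * ∑' x : u, l * volume (Metric.ball (x : Eucl d) (r x)) := by
        simp_rw [← ENNReal.tsum_mul_left]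
        refine tsum_congr fun x => ?_
        rw [volume_ball_mul _ (by norm_num : (0 : ℝ) < 4)]
        norm_num
        ring
    _ ≤ 4 ^ d * ∑' x : u, μ (Metric.ball (x : Eucl d) (r x)) := by
        gcongr with x
        exact hr x (huA x.2)
    _ = 4 ^ d * μ (⋃ x ∈ u, Metric.ball x (r x)) := by
        rw [measure_biUnion hcount hdisj fun _ _ => Metric.isOpen_ball.measurableSet]
    _ ≤ 4 ^ d * μ univ := by gcongr; exact subset_univ _

/-- The weak type `(1, 1)` estimate for the maximal function. -/
lemma mul_volume_lt_maximalFun_le (μ : Measure (Eucl d)) (l : ℝ≥0∞) :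
    l * volume {x | l < maximalFun μ x} ≤ 4 ^ d * μ univ := by
  -- Radii are capped at `n` so that the Vitali selection applies; the bound is uniform in `n` and
  -- passes to the increasing union.
  set A : ℕ → Set (Eucl d) := fun n =>
    {x | ∃ r : ℝ, 0 < r ∧ r ≤ n ∧ l * volume (Metric.ball x r) < μ (Metric.ball x r)}
  have hA : {x | l < maximalFun μ x} = ⋃ n, A n := by
    ext x
    simp only [mem_ofPred_eq, lt_maximalFun_iff, mem_iUnion, A]
    constructor
    · rintro ⟨r, hr, h⟩
      obtain ⟨n, hn⟩ := exists_nat_ge r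
      exact ⟨n, r, hr, hn, h⟩
    · rintro ⟨n, r, hr, -, h⟩
      exact ⟨r, hr, h⟩
  have hmono : Monotone A := fun m n hmn x => by
    rintro ⟨r, hr, hrm, h⟩
    exact ⟨r, hr, hrm.trans (by exact_mod_cast hmn), h⟩
  rw [hA, hmono.measure_iUnion, ENNReal.mul_iSup]
  exact iSup_le fun n => mul_volume_le_of_forall_exists_ball μ l n _ fun x ⟨r, h0, h1, h2⟩ =>
    ⟨r, h0, h1, h2.le⟩

/-- An open ball is exhausted by smaller concentric balls, and each of these lies in `Metric.ball y
r` for all `y` close to `x`. -/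
lemma lowerSemicontinuous_measure_ball (μ : Measure (Eucl d)) (r : ℝ) :
    LowerSemicontinuous fun x => μ (Metric.ball x r) := by
  intro x l hl
  have hU : Metric.ball x r = ⋃ n : ℕ, Metric.ball x (r - 1 / (n + 1)) := by
    ext y
    simp only [Metric.mem_ball, mem_iUnion]
    constructor
    · intro h
      obtain ⟨n, hn⟩ := exists_nat_one_div_lt (sub_pos.2 h)
      exact ⟨n, by linarith⟩
    · rintro ⟨n, hn⟩
      have : (0 : ℝ) < 1 / (n + 1) := Nat.one_div_pos_of_nat
      linarith
  have hmono : Monotone fun n : ℕ => Metric.ball x (r - 1 / ((n : ℝ) + 1)) := fun m n h =>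
    Metric.ball_subset_ball (by
      have := Nat.one_div_le_one_div (α := ℝ) h
      linarith)
  beta_reduce at hl
  rw [hU, hmono.measure_iUnion, gt_iff_lt, lt_iSup_iff] at hl
  obtain ⟨n, hn⟩ := hl
  filter_upwards [Metric.ball_mem_nhds x (Nat.one_div_pos_of_nat (α := ℝ) (n := n))] with y hy
  refine hn.trans_le (measure_mono (Metric.ball_subset_ball' ?_))
  rw [Metric.mem_ball, dist_comm] at hy
  linarith

lemma measurable_maximalFun (μ : Measure (Eucl d)) : Measurable (maximalFun μ) := by
  refine LowerSemicontinuous.measurable ?_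
  refine lowerSemicontinuous_iSup fun r => lowerSemicontinuous_iSup fun _ => ?_
  intro x l hl
  have hvol : ∀ y : Eucl d, volume (Metric.ball y r) = volume (Metric.ball (0 : Eucl d) r) :=
    fun y => Measure.addHaar_ball_center volume y r
  simp only [hvol] at hl ⊢
  have h0 := volume_ball_pos (0 : Eucl d) ‹0 < r›
  have ht := volume_ball_ne_top (0 : Eucl d) r
  rw [gt_iff_lt, ENNReal.lt_div_iff_mul_lt (Or.inl h0) (Or.inl ht)] at hl
  filter_upwards [lowerSemicontinuous_measure_ball μ r x _ hl] with y hy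
  rwa [gt_iff_lt, ENNReal.lt_div_iff_mul_lt (Or.inl h0) (Or.inl ht)]

/-- A reverse weak type estimate at a set of points of large density. -/
lemma measure_le_mul_volume_lt_maximalFun (ν : Measure (Eucl d)) [IsFiniteMeasure ν]
    {s : ℝ≥0∞} (hs0 : s ≠ 0) (hs : s ≠ ∞) {ρ : ℝ}
    (hsρ : ν univ < 2 * 3 ^ d * s * volume (Metric.ball (0 : Eucl d) ρ))
    (A B : Set (Eucl d)) (hAB : ∀ x ∈ A, Metric.closedBall x ρ ⊆ B)
    (hA : ∀ x ∈ A, ∃ r : ℝ, 0 < r ∧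
      2 * 3 ^ d * s * volume (Metric.closedBall x r) ≤ ν (Metric.closedBall x r)) :
    ν A ≤ 2 * 15 ^ d * (s * volume (B ∩ {x | s < maximalFun ν x})) := by
  set l : ℝ≥0∞ := 2 * 3 ^ d * s with hl
  set S : Eucl d → Set ℝ := fun x =>
    {r | 0 < r ∧ l * volume (Metric.closedBall x r) ≤ ν (Metric.closedBall x r)}
  -- A ball of radius at least `ρ` with density `l` would carry more than the total mass. Hence
  -- admissible radii are below `ρ` and the balls stay inside `B`.
  have hSρ : ∀ x, ∀ r ∈ S x, r < ρ := fun x r hr => by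
    by_contra! h
    refine lt_irrefl (ν univ) (hsρ.trans_le ?_)
    rw [← Measure.addHaar_ball_center volume x ρ]
    calc l * volume (Metric.ball x ρ) ≤ l * volume (Metric.closedBall x r) := by
          gcongr
          exact Metric.ball_subset_closedBall.trans (Metric.closedBall_subset_closedBall h)
      _ ≤ ν univ := hr.2.trans (measure_mono (subset_univ _))
  -- A radius above half the supremum of `S x` works. The ball has density at least `l`, but its
  -- Vitali enlargement does not, so the mass of the latter is bounded by its volume.
  have hex : ∀ x ∈ A, ∃ r ∈ S x, 4 * r ∉ S x := fun x hx => by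
    obtain ⟨r0, hr0⟩ : (S x).Nonempty := hA x hx
    have hbdd : BddAbove (S x) := ⟨ρ, fun r hr => (hSρ x r hr).le⟩
    have hpos : 0 < sSup (S x) := hr0.1.trans_le (le_csSup hbdd hr0)
    obtain ⟨r, hr, hlt⟩ := exists_lt_of_lt_csSup ⟨r0, hr0⟩ (half_lt_self hpos)
    refine ⟨r, hr, fun h => ?_⟩
    have := le_csSup hbdd h
    linarith
  choose! r hrS hr4 using hex
  obtain ⟨u, huA, hdisj, hcov⟩ := Vitali.exists_disjoint_subfamily_covering_enlargement_closedBall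
    A id r ρ (fun x hx => (hSρ x _ (hrS x hx)).le) 4 (by norm_num)
  simp only [id] at hdisj hcov
  have hr0 : ∀ x ∈ A, 0 < r x := fun x hx => (hrS x hx).1
  have hcount : u.Countable := hdisj.countable_of_nonempty_interior fun x hx =>
    ⟨x, Metric.ball_subset_interior_closedBall (Metric.mem_ball_self (hr0 x (huA hx)))⟩
  have hsub : A ⊆ ⋃ x ∈ u, Metric.closedBall x (4 * r x) := fun x hx => by
    obtain ⟨y, hy, hxy⟩ := hcov x hx
    exact mem_iUnion₂.2 ⟨y, hy, hxy (Metric.mem_closedBall_self (hr0 x hx).le)⟩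
  have := hcount.to_subtype
  have hl0 : l ≠ 0 := by simp [hl, hs0]
  have hlt : l ≠ ∞ := by
    simp only [hl]
    finiteness
  -- Every point `y` of a selected ball sees it inside `Metric.ball y (3 * r x)`, which costs `3 ^
  -- d` in volume; the spare factor 2 in `l` makes the inequality strict.
  have hmem : ⋃ x ∈ u, Metric.closedBall x (r x) ⊆ B ∩ {x | s < maximalFun ν x} := by
    refine iUnion₂_subset fun x hx y hy => ⟨?_, ?_⟩
    · exact hAB x (huA hx) (Metric.closedBall_subset_closedBall (hSρ x _ (hrS x (huA hx))).le hy)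
    · have hx0 := hr0 x (huA hx)
      rw [mem_ofPred_eq, lt_maximalFun_iff]
      refine ⟨3 * r x, by positivity, ?_⟩
      have hxy : Metric.closedBall x (r x) ⊆ Metric.ball y (3 * r x) := by
        refine Metric.closedBall_subset_ball' ?_
        rw [Metric.mem_closedBall, dist_comm] at hy
        linarith
      have hvy : volume (Metric.ball y (r x)) = volume (Metric.ball x (r x)) := by
        rw [Measure.addHaar_ball_center, Measure.addHaar_ball_center volume x]
      have hfin : s * volume (Metric.ball y (3 * r x)) ≠ ∞ :=
        ENNReal.mul_ne_top hs (volume_ball_ne_top _ _)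
      have hne : s * volume (Metric.ball y (3 * r x)) ≠ 0 :=
        mul_ne_zero hs0 (volume_ball_pos _ (by positivity))
      calc s * volume (Metric.ball y (3 * r x))
          < 2 * (s * volume (Metric.ball y (3 * r x))) := by
            rw [two_mul]
            exact ENNReal.lt_add_right hfin hne
        _ = l * volume (Metric.ball x (r x)) := by
            rw [volume_ball_mul _ (by norm_num : (0 : ℝ) < 3), hvy, hl]
            norm_num
            ring
        _ ≤ l * volume (Metric.closedBall x (r x)) := by
            gcongr
            exact Metric.ball_subset_closedBall
        _ ≤ ν (Metric.closedBall x (r x)) := (hrS x (huA hx)).2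
        _ ≤ ν (Metric.ball y (3 * r x)) := measure_mono hxy
  -- The closed ball of radius `4 * r x` is put into the open ball of radius `5 * r x`, so the
  -- constant is `2 * 3 ^ d * 5 ^ d`.
  calc ν A ≤ ∑' x : u, ν (Metric.closedBall (x : Eucl d) (4 * r x)) :=
        (measure_mono hsub).trans (measure_biUnion_le ν hcount _)
    _ ≤ ∑' x : u, l * (5 ^ d * volume (Metric.closedBall (x : Eucl d) (r x))) := by
        refine ENNReal.tsum_le_tsum fun x => ?_
        have hx0 := hr0 x (huA x.2)
        have h4 := hr4 x (huA x.2)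
        simp only [S, mem_ofPred_eq, not_and, not_le] at h4
        refine (h4 (by positivity)).le.trans ?_
        gcongr
        calc volume (Metric.closedBall (x : Eucl d) (4 * r x))
            ≤ volume (Metric.ball (x : Eucl d) (5 * r x)) :=
              measure_mono (Metric.closedBall_subset_ball (by linarith))
          _ = 5 ^ d * volume (Metric.ball (x : Eucl d) (r x)) := by
              rw [volume_ball_mul _ (by norm_num : (0 : ℝ) < 5)]
              norm_num
          _ ≤ _ := by
              gcongr
              exact Metric.ball_subset_closedBall
    _ = l * (5 ^ d * volume (⋃ x ∈ u, Metric.closedBall x (r x))) := by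
        rw [measure_biUnion hcount hdisj fun _ _ => Metric.isClosed_closedBall.measurableSet]
        simp_rw [ENNReal.tsum_mul_left]
    _ ≤ l * (5 ^ d * volume (B ∩ {x | s < maximalFun ν x})) := by gcongr
    _ = _ := by
        rw [hl, show (15 : ℝ≥0∞) = 3 * 5 by norm_num, mul_pow]
        ring

end MaximalFunction

/-! ### Layer-cake formula and logarithmic growth of truncated integrals. -/

section TruncatedIntegral

variable {d : ℕ}

/-- Layer cake: truncating `g` at height `a` removes exactly the levels `t ≥ a`. The truncation is
finite, which allows passing to a real-valued function. -/
lemma lintegral_min_ofReal_eq {α : Type*} [MeasurableSpace α] (μ : Measure α) {g : α → ℝ≥0∞}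
    (hg : Measurable g) (a : ℝ) :
    ∫⁻ x, min (ENNReal.ofReal a) (g x) ∂μ =
      ∫⁻ t in Ioo 0 a, μ {x | ENNReal.ofReal t < g x} := by
  have hm : Measurable fun x => min (ENNReal.ofReal a) (g x) := measurable_const.min hg
  have hfin : ∀ x, min (ENNReal.ofReal a) (g x) ≠ ∞ := fun x =>
    ne_top_of_le_ne_top ENNReal.ofReal_ne_top (min_le_left _ _)
  have h1 : ∫⁻ x, min (ENNReal.ofReal a) (g x) ∂μ =
      ∫⁻ x, ENNReal.ofReal (min (ENNReal.ofReal a) (g x)).toReal ∂μ :=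
    lintegral_congr fun x => (ENNReal.ofReal_toReal (hfin x)).symm
  rw [h1, lintegral_eq_lintegral_meas_lt μ (ae_of_all _ fun x => ENNReal.toReal_nonneg)
    hm.ennreal_toReal.aemeasurable]
  have h3 : ∀ t ∈ Ioi (0 : ℝ), μ {x | t < (min (ENNReal.ofReal a) (g x)).toReal} =
      (Ioo 0 a).indicator (fun t => μ {x | ENNReal.ofReal t < g x}) t := fun t ht => by
    have h4 : ∀ x, t < (min (ENNReal.ofReal a) (g x)).toReal ↔ t < a ∧ ENNReal.ofReal t < g x :=
      fun x => by
        rw [← ENNReal.ofReal_lt_iff_lt_toReal (le_of_lt ht) (hfin x), lt_min_iff,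
          ENNReal.ofReal_lt_ofReal_iff_of_nonneg (le_of_lt ht)]
    simp_rw [h4]
    by_cases hta : t < a
    · rw [indicator_of_mem (show t ∈ Ioo 0 a from ⟨ht, hta⟩)]
      simp [hta]
    · rw [indicator_of_notMem fun h => hta h.2]
      simp [hta]
  rw [setLIntegral_congr_fun measurableSet_Ioi h3, setLIntegral_indicator measurableSet_Ioo,
    inter_eq_left.2 fun t ht => ht.1]

lemma lintegral_Ioo_ofReal_inv {a b : ℝ} (ha : 0 < a) (hab : a ≤ b) :
    ∫⁻ t in Ioo a b, (ENNReal.ofReal t)⁻¹ = ENNReal.ofReal (Real.log (b / a)) := by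
  have h0 : (0 : ℝ) ∉ uIcc a b := by
    rw [uIcc_of_le hab]
    exact fun h => ha.not_ge h.1
  have hint : IntervalIntegrable (fun t : ℝ => 1 / t) volume a b :=
    intervalIntegral.intervalIntegrable_one_div (fun x hx h => h0 (h ▸ hx)) continuousOn_id
  rw [← integral_one_div h0, intervalIntegral.integral_of_le hab, ofReal_integral_eq_lintegral_ofReal]
  · rw [setLIntegral_congr Ioo_ae_eq_Ioc]
    refine setLIntegral_congr_fun measurableSet_Ioc fun t ht => ?_
    rw [one_div, ENNReal.ofReal_inv_of_pos (ha.trans ht.1)]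
  · exact (intervalIntegrable_iff_integrableOn_Ioc_of_le hab).1 hint
  · filter_upwards [self_mem_ae_restrict measurableSet_Ioc] with t ht
    exact one_div_nonneg.2 (ha.trans ht.1).le

/-- Levels below 1 are bounded by `volume B`; on levels from 1 to `δ⁻¹` the weak type estimate gives
a multiple of `1 / t`, whose integral is `|log δ|`. -/
lemma lintegral_min_maximalFun_le (μ : Measure (Eucl d)) (B : Set (Eucl d)) {δ : ℝ}
    (hδ0 : 0 < δ) (hδ1 : δ < 1) :
    ∫⁻ x in B, min (ENNReal.ofReal δ⁻¹) (maximalFun μ x) ≤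
      volume B + 4 ^ d * μ univ * ENNReal.ofReal |Real.log δ| := by
  have hδ : 1 < δ⁻¹ := (one_lt_inv₀ hδ0).2 hδ1
  rw [lintegral_min_ofReal_eq _ (measurable_maximalFun μ)]
  have hsub : Ioo 0 δ⁻¹ ⊆ Ioc 0 1 ∪ Ioo 1 δ⁻¹ := fun t ht => by
    by_cases h : t ≤ 1
    · exact Or.inl ⟨ht.1, h⟩
    · exact Or.inr ⟨not_le.1 h, ht.2⟩
  refine (lintegral_mono_set hsub).trans ((lintegral_union_le _ _ _).trans (add_le_add ?_ ?_))
  · calc ∫⁻ t in Ioc (0 : ℝ) 1, volume.restrict B {x | ENNReal.ofReal t < maximalFun μ x}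
        ≤ ∫⁻ t in Ioc (0 : ℝ) 1, volume B := by
          refine lintegral_mono fun t => ?_
          exact (measure_mono (subset_univ _)).trans_eq (Measure.restrict_apply_univ B)
      _ = volume B := by simp
  · calc ∫⁻ t in Ioo 1 δ⁻¹, volume.restrict B {x | ENNReal.ofReal t < maximalFun μ x}
        ≤ ∫⁻ t in Ioo 1 δ⁻¹, 4 ^ d * μ univ * (ENNReal.ofReal t)⁻¹ := by
          refine setLIntegral_mono' measurableSet_Ioo fun t ht => ?_
          have ht0 : ENNReal.ofReal t ≠ 0 := by
            simpa using zero_lt_one.trans ht.1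
          rw [← div_eq_mul_inv, ENNReal.le_div_iff_mul_le (Or.inl ht0)
            (Or.inl ENNReal.ofReal_ne_top), mul_comm]
          refine le_trans ?_ (mul_volume_lt_maximalFun_le μ (ENNReal.ofReal t))
          gcongr
          exact Measure.restrict_le_self
      _ = 4 ^ d * μ univ * ENNReal.ofReal |Real.log δ| := by
          rw [lintegral_const_mul _ (by fun_prop), lintegral_Ioo_ofReal_inv one_pos hδ.le, div_one,
            Real.log_inv, abs_of_neg (Real.log_neg hδ0 hδ1)]

lemma tendsto_ofReal_abs_log :
    Tendsto (fun δ : ℝ => ENNReal.ofReal |Real.log δ|) (𝓝[>] 0) (𝓝 ∞) :=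
  ENNReal.tendsto_ofReal_atTop.comp
    (tendsto_abs_atBot_atTop.comp Real.tendsto_log_nhdsGT_zero)

lemma eventually_mem_Ioo_zero_one : ∀ᶠ δ : ℝ in 𝓝[>] 0, δ ∈ Ioo (0 : ℝ) 1 :=
  Ioo_mem_nhdsGT one_pos

lemma ofReal_abs_log_ne_zero {δ : ℝ} (h : δ ∈ Ioo (0 : ℝ) 1) :
    ENNReal.ofReal |Real.log δ| ≠ 0 := by
  simpa using (Real.log_neg h.1 h.2).ne

/-- If `M μ ≤ K + M ν` on `B`, the truncated integrals of `M μ` are asymptotically controlled by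
the mass of `ν`. -/
lemma limsup_truncated_le_of_maximalFun_le (μ ν : Measure (Eucl d)) {B : Set (Eucl d)}
    (hB : MeasurableSet B) (hB' : volume B ≠ ∞) {K : ℝ≥0∞} (hK : K ≠ ∞)
    (h : ∀ x ∈ B, maximalFun μ x ≤ K + maximalFun ν x) :
    limsup (fun δ : ℝ => (ENNReal.ofReal |Real.log δ|)⁻¹ *
      ∫⁻ x in B, min (ENNReal.ofReal δ⁻¹) (maximalFun μ x)) (𝓝[>] 0) ≤ 4 ^ d * ν univ := by
  have hlim : Tendsto (fun δ : ℝ => (ENNReal.ofReal |Real.log δ|)⁻¹ * ((K + 1) * volume B) +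
      4 ^ d * ν univ) (𝓝[>] 0) (𝓝 (4 ^ d * ν univ)) := by
    have h1 := tendsto_inv_iff.2 tendsto_ofReal_abs_log
    have h2 := (ENNReal.Tendsto.mul_const h1
      (Or.inr (by finiteness : (K + 1) * volume B ≠ ∞))).add_const (4 ^ d * ν univ)
    simpa using h2
  rw [← hlim.limsup_eq]
  refine limsup_le_limsup ?_
  filter_upwards [eventually_mem_Ioo_zero_one] with δ hδ
  have hl0 := ofReal_abs_log_ne_zero hδ
  calc (ENNReal.ofReal |Real.log δ|)⁻¹ *
      ∫⁻ x in B, min (ENNReal.ofReal δ⁻¹) (maximalFun μ x)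
      ≤ (ENNReal.ofReal |Real.log δ|)⁻¹ *
        ∫⁻ x in B, (K + min (ENNReal.ofReal δ⁻¹) (maximalFun ν x)) := by
        gcongr 1
        refine setLIntegral_mono' hB fun x hx => ?_
        refine (min_le_min_left _ (h x hx)).trans ?_
        rw [← min_add_add_left]
        exact min_le_min_right _ le_add_self
    _ ≤ (ENNReal.ofReal |Real.log δ|)⁻¹ *
        (K * volume B + (volume B + 4 ^ d * ν univ * ENNReal.ofReal |Real.log δ|)) := by
        gcongr 1
        rw [lintegral_add_left measurable_const, setLIntegral_const]
        gcongr
        exact lintegral_min_maximalFun_le ν B hδ.1 hδ.2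
    _ = _ := by
        rw [← add_assoc, ← add_one_mul, mul_add, mul_comm (4 ^ d * ν univ), ← mul_assoc _ _ (4 ^ d * _),
          ENNReal.inv_mul_cancel hl0 ENNReal.ofReal_ne_top, one_mul]

end TruncatedIntegral

/-! ### Upper and lower limits for a single finite measure. -/

section SliceLimits

variable {d : ℕ}

lemma maximalFun_le_of_le_smul {μ : Measure (Eucl d)} {K : ℝ≥0∞} (h : μ ≤ K • volume)
    (x : Eucl d) : maximalFun μ x ≤ K := by
  refine iSup₂_le fun r hr => ENNReal.div_le_of_le_mul ?_
  simpa using h (Metric.ball x r)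

/-- Radii up to `ε` see no mass, and larger ones divide by at least the volume of a ball of radius
`ε`. -/
lemma maximalFun_le_of_ball_eq_zero {μ : Measure (Eucl d)} {x : Eucl d} {ε : ℝ}
    (h : μ (Metric.ball x ε) = 0) :
    maximalFun μ x ≤ μ univ / volume (Metric.ball (0 : Eucl d) ε) := by
  refine iSup₂_le fun r _ => ?_
  rcases le_total r ε with hr | hr
  · rw [measure_mono_null (Metric.ball_subset_ball hr) h, ENNReal.zero_div]
    exact zero_le
  · refine ENNReal.div_le_div (measure_mono (subset_univ _)) ?_
    rw [← Measure.addHaar_ball_center volume x ε]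
    exact measure_mono (Metric.ball_subset_ball hr)

/-- The density is finite almost everywhere, so the sets where it exceeds `n` decrease to a null
set. This makes the unbounded part of the density negligible in the upper bound. -/
lemma tendsto_withDensity_rnDeriv_lt (μ : Measure (Eucl d)) [IsFiniteMeasure μ] :
    Tendsto (fun n : ℕ => volume.withDensity (μ.rnDeriv volume) {x | (n : ℝ≥0∞) <
      μ.rnDeriv volume x}) atTop (𝓝 0) := by
  have hm := Measure.measurable_rnDeriv μ (volume : Measure (Eucl d))
  have hnull : volume.withDensity (μ.rnDeriv volume) (⋂ n : ℕ, {x | (n : ℝ≥0∞) <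
      μ.rnDeriv volume x}) = 0 := by
    refine withDensity_absolutelyContinuous _ _ ?_
    refine measure_mono_null ?_ (ae_iff.1 (Measure.rnDeriv_lt_top μ (volume : Measure (Eucl d))))
    intro x hx h
    obtain ⟨n, hn⟩ := ENNReal.exists_nat_gt h.ne
    exact lt_asymm hn (mem_iInter.1 hx n)
  rw [← hnull]
  refine tendsto_measure_iInter_atTop
    (fun n => (measurableSet_lt measurable_const hm).nullMeasurableSet) (fun m n hmn x hx => ?_)
    ⟨0, ?_⟩
  · exact lt_of_le_of_lt (Nat.cast_le.2 hmn) (show (n : ℝ≥0∞) < _ from hx)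
  · exact ne_top_of_le_ne_top (measure_ne_top μ univ)
      ((measure_mono (subset_univ _)).trans (Measure.withDensity_rnDeriv_le μ volume univ))

/-- The upper bound for the truncated integrals of the maximal function of a finite measure. -/
lemma limsup_truncated_le (μ : Measure (Eucl d)) [IsFiniteMeasure μ] (x₀ : Eucl d) (r : ℝ) :
    limsup (fun δ : ℝ => (ENNReal.ofReal |Real.log δ|)⁻¹ *
      ∫⁻ x in Metric.ball x₀ r, min (ENNReal.ofReal δ⁻¹) (maximalFun μ x)) (𝓝[>] 0) ≤
      4 ^ d * μ.singularPart volume (closure (Metric.ball x₀ r)) := by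
  set B := Metric.ball x₀ r
  set σ := μ.singularPart volume
  set f := μ.rnDeriv volume
  set α := (volume : Measure (Eucl d)).withDensity f
  have hm : Measurable f := Measure.measurable_rnDeriv μ volume
  set U : ℕ → Set (Eucl d) := fun n => Metric.thickening (1 / ((n : ℝ) + 1)) B
  set F : ℕ → Set (Eucl d) := fun n => {x | (n : ℝ≥0∞) < f x}
  have hF : ∀ n, MeasurableSet (F n) := fun n => measurableSet_lt measurable_const hm
  have hU : ∀ n, MeasurableSet (U n) := fun n => Metric.isOpen_thickening.measurableSet
  -- Thickenings of `B` shrink to its closure, which is why the closed ball appears in the upper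
  -- bound.
  have hlim : Tendsto (fun n => 4 ^ d * (σ (U n) + α (F n))) atTop
      (𝓝 (4 ^ d * σ (closure B))) := by
    have h1 : Tendsto (fun n => σ (U n)) atTop (𝓝 (σ (closure B))) :=
      (tendsto_measure_thickening ⟨1, one_pos, measure_ne_top _ _⟩).comp
        (tendsto_nhdsWithin_iff.2 ⟨tendsto_one_div_add_atTop_nhds_zero_nat,
          Eventually.of_forall fun n => mem_Ioi.2 Nat.one_div_pos_of_nat⟩)
    have h2 := ENNReal.Tendsto.const_mul (a := 4 ^ d) (h1.add (tendsto_withDensity_rnDeriv_lt μ))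
      (Or.inr (by finiteness))
    rwa [add_zero] at h2
  refine ge_of_tendsto' hlim fun n => ?_
  have hε : (0 : ℝ) < 1 / ((n : ℝ) + 1) := Nat.one_div_pos_of_nat
  -- The first bracket is kept through its mass. The second has bounded maximal function on `B`: its
  -- singular part keeps a distance `1 / (n + 1)` from each point of `B`, and its density is at most
  -- `n`.
  have hdecomp : μ = (σ.restrict (U n) + α.restrict (F n)) +
      (σ.restrict (U n)ᶜ + α.restrict (F n)ᶜ) := by
    conv_lhs => rw [← Measure.singularPart_add_rnDeriv μ volume]
    rw [add_add_add_comm, Measure.restrict_add_restrict_compl (hU n),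
      Measure.restrict_add_restrict_compl (hF n)]
  have hmass : σ (U n) + α (F n) = (σ.restrict (U n) + α.restrict (F n)) univ := by simp
  rw [hmass]
  refine limsup_truncated_le_of_maximalFun_le (K := σ univ /
    volume (Metric.ball (0 : Eucl d) (1 / ((n : ℝ) + 1))) + n) μ _ measurableSet_ball
    measure_ball_lt_top.ne ?_ fun x hx => ?_
  · exact ENNReal.add_ne_top.2 ⟨ENNReal.div_ne_top (measure_ne_top _ _) (volume_ball_pos _ hε),
      ENNReal.natCast_ne_top n⟩
  · conv_lhs => rw [hdecomp]
    rw [add_comm _ (maximalFun _ x)]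
    refine (maximalFun_add_le _ _ x).trans (add_le_add le_rfl ?_)
    refine (maximalFun_add_le _ _ x).trans (add_le_add ?_ ?_)
    · refine (maximalFun_le_of_ball_eq_zero (ε := 1 / ((n : ℝ) + 1)) ?_).trans ?_
      · rw [Measure.restrict_apply measurableSet_ball]
        refine measure_mono_null (t := ∅) ?_ measure_empty
        rintro y ⟨hy, hy'⟩
        exact hy' (Metric.mem_thickening_iff.2 ⟨x, hx, hy⟩)
      · gcongr
        exact Measure.restrict_le_self
    · refine maximalFun_le_of_le_smul (Measure.le_iff.2 fun A hA => ?_) x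
      rw [Measure.restrict_apply hA, withDensity_apply _ (hA.inter (hF n).compl)]
      calc ∫⁻ y in A ∩ (F n)ᶜ, f y ≤ ∫⁻ y in A ∩ (F n)ᶜ, (n : ℝ≥0∞) :=
            setLIntegral_mono' (hA.inter (hF n).compl) fun y hy => not_lt.1 hy.2
        _ ≤ (n : ℝ≥0∞) * volume A := by
            rw [setLIntegral_const]
            gcongr
            exact inter_subset_left
        _ = _ := by simp

/-- Almost every point for a singular measure is a point of infinite density. -/
lemma ae_exists_mul_volume_closedBall_le (ν : Measure (Eucl d)) [IsFiniteMeasure ν]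
    (hν : ν ⟂ₘ volume) :
    ∀ᵐ x ∂ν, ∀ l : ℝ≥0∞, l ≠ ∞ → ∃ r : ℝ, 0 < r ∧
      l * volume (Metric.closedBall x r) ≤ ν (Metric.closedBall x r) := by
  -- Lebesgue measure is differentiated with respect to `ν`, not conversely: the ratio volume over
  -- `ν` tends to 0 at `ν`-a.e. point.
  filter_upwards [Besicovitch.ae_tendsto_rnDeriv volume ν, hν.symm.rnDeriv_ae_eq_zero]
    with x hx hx0 l hl
  rw [hx0] at hx
  -- Using `l + 1` avoids treating `l = 0` separately.
  have hl' : (0 : ℝ≥0∞) < (l + 1)⁻¹ := ENNReal.inv_pos.2 (by finiteness)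
  obtain ⟨r, hr, hr0⟩ := ((hx.eventually (gt_mem_nhds hl')).and self_mem_nhdsWithin).exists
  refine ⟨r, hr0, ?_⟩
  have hvol : volume (Metric.closedBall x r) ≠ 0 :=
    (Metric.measure_closedBall_pos volume x hr0).ne'
  rw [ENNReal.div_lt_iff (Or.inr hvol) (Or.inl (measure_ne_top _ _)), mul_comm, ← div_eq_mul_inv,
    ENNReal.lt_div_iff_mul_lt (Or.inl (by simp)) (Or.inl (by finiteness)), mul_comm] at hr
  exact le_trans (by gcongr; exact le_self_add) hr.le

/-- Integrating the lower bound `c / s` over `s₀ < s < δ⁻¹` gives `c * (|log δ| - log s₀)`, and the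
fixed term `log s₀` is lost after normalisation. -/
lemma le_liminf_truncated_of_forall_le {g : Eucl d → ℝ≥0∞} (hg : Measurable g)
    {B : Set (Eucl d)} {c : ℝ≥0∞} {s₀ : ℝ} (hs₀ : 0 < s₀)
    (h : ∀ s : ℝ, s₀ ≤ s → c ≤ ENNReal.ofReal s * volume (B ∩ {x | ENNReal.ofReal s < g x})) :
    c ≤ liminf (fun δ : ℝ => (ENNReal.ofReal |Real.log δ|)⁻¹ *
      ∫⁻ x in B, min (ENNReal.ofReal δ⁻¹) (g x)) (𝓝[>] 0) := by
  have hlim : Tendsto (fun δ : ℝ => c * ENNReal.ofReal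
      ((|Real.log δ| - Real.log s₀) / |Real.log δ|)) (𝓝[>] 0) (𝓝 c) := by
    have hL : Tendsto (fun δ : ℝ => |Real.log δ|) (𝓝[>] 0) atTop :=
      tendsto_abs_atBot_atTop.comp Real.tendsto_log_nhdsGT_zero
    have h1 : Tendsto (fun δ : ℝ => 1 - Real.log s₀ / |Real.log δ|) (𝓝[>] 0) (𝓝 1) := by
      simpa using (hL.const_div_atTop (Real.log s₀)).const_sub 1
    have h2 : Tendsto (fun δ : ℝ => (|Real.log δ| - Real.log s₀) / |Real.log δ|)
        (𝓝[>] 0) (𝓝 1) := by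
      refine h1.congr' ?_
      filter_upwards [hL.eventually_gt_atTop 0] with δ hδ
      field_simp
    simpa using ENNReal.Tendsto.const_mul (a := c) (ENNReal.tendsto_ofReal h2) (Or.inl (by simp))
  rw [← hlim.liminf_eq]
  refine liminf_le_liminf ?_
  filter_upwards [eventually_mem_Ioo_zero_one, Ioo_mem_nhdsGT (inv_pos.2 hs₀)] with δ hδ hδs
  have hδs' : s₀ ≤ δ⁻¹ := (le_inv_comm₀ hs₀ hδ.1).2 hδs.2.le
  have hL : 0 < |Real.log δ| := abs_pos.2 (Real.log_neg hδ.1 hδ.2).ne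
  rw [lintegral_min_ofReal_eq _ hg, ENNReal.ofReal_div_of_pos hL,
    div_eq_mul_inv, ← mul_assoc, mul_comm]
  gcongr
  calc c * ENNReal.ofReal (|Real.log δ| - Real.log s₀)
      = c * ∫⁻ t in Ioo s₀ δ⁻¹, (ENNReal.ofReal t)⁻¹ := by
        rw [lintegral_Ioo_ofReal_inv hs₀ hδs', Real.log_div (inv_ne_zero hδ.1.ne') hs₀.ne',
          Real.log_inv, abs_of_neg (Real.log_neg hδ.1 hδ.2)]
    _ = ∫⁻ t in Ioo s₀ δ⁻¹, c * (ENNReal.ofReal t)⁻¹ :=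
        (lintegral_const_mul _ (by fun_prop)).symm
    _ ≤ ∫⁻ t in Ioo s₀ δ⁻¹, volume.restrict B {x | ENNReal.ofReal t < g x} := by
        refine setLIntegral_mono' measurableSet_Ioo fun t ht => ?_
        rw [Measure.restrict_apply (measurableSet_lt measurable_const hg), inter_comm,
          ← div_eq_mul_inv]
        refine ENNReal.div_le_of_le_mul ?_
        rw [mul_comm]
        exact h t ht.1.le
    _ ≤ ∫⁻ t in Ioo 0 δ⁻¹, volume.restrict B {x | ENNReal.ofReal t < g x} :=
        lintegral_mono_set (Ioo_subset_Ioo_left hs₀.le)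

/-- The lower bound for the truncated integrals of the maximal function of a finite measure. -/
lemma singularPart_ball_le_liminf_truncated (μ : Measure (Eucl d)) [IsFiniteMeasure μ]
    (x₀ : Eucl d) (r : ℝ) :
    μ.singularPart volume (Metric.ball x₀ r) ≤
      2 * 15 ^ d * liminf (fun δ : ℝ => (ENNReal.ofReal |Real.log δ|)⁻¹ *
        ∫⁻ x in Metric.ball x₀ r, min (ENNReal.ofReal δ⁻¹) (maximalFun μ x)) (𝓝[>] 0) := by
  set B := Metric.ball x₀ r with hB
  set ν := μ.singularPart volume
  have hνμ : ν ≤ μ := Measure.singularPart_le μ volume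
  set G : Set (Eucl d) := {x | ∀ l : ℝ≥0∞, l ≠ ∞ → ∃ r : ℝ, 0 < r ∧
      l * volume (Metric.closedBall x r) ≤ ν (Metric.closedBall x r)}
  have hG : ∀ᵐ x ∂ν, x ∈ G :=
    ae_exists_mul_volume_closedBall_le ν (Measure.mutuallySingular_singularPart μ volume)
  -- Slightly smaller concentric balls leave room for closed balls of a fixed radius `ρ` inside `B`,
  -- as the reverse weak type estimate requires.
  set A : ℕ → Set (Eucl d) := fun n => G ∩ Metric.ball x₀ (r - 1 / ((n : ℝ) + 1)) with hA
  have hmono : Monotone A := fun m n h => inter_subset_inter_right _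
    (Metric.ball_subset_ball (by
      have := Nat.one_div_le_one_div (α := ℝ) h
      linarith))
  have hunion : ν B = ⨆ n, ν (A n) := by
    rw [← hmono.measure_iUnion]
    refine measure_congr ?_
    have hUn : ⋃ n, A n = G ∩ B := by
      rw [← inter_iUnion]
      congr 1
      ext y
      simp only [hB, Metric.mem_ball, mem_iUnion]
      constructor
      · rintro ⟨n, hn⟩
        have : (0 : ℝ) < 1 / (n + 1) := Nat.one_div_pos_of_nat
        linarith
      · intro h
        obtain ⟨n, hn⟩ := exists_nat_one_div_lt (sub_pos.2 h)
        exact ⟨n, by linarith⟩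
    rw [hUn]
    filter_upwards [hG] with x hx
    exact propext ⟨fun h => ⟨hx, h⟩, fun h => h.2⟩
  rw [hunion]
  refine iSup_le fun n => ?_
  set ρ : ℝ := 1 / ((n : ℝ) + 1) / 2 with hρ
  have hn : (0 : ℝ) < 1 / ((n : ℝ) + 1) := Nat.one_div_pos_of_nat
  have hρ0 : 0 < ρ := half_pos hn
  have hvol := volume_ball_pos (0 : Eucl d) hρ0
  have hvol' := volume_ball_ne_top (0 : Eucl d) ρ
  -- Beyond level `m` the total mass of `ν` is too small for a ball of radius `ρ`, so the reverse
  -- estimate holds at every `s ≥ m + 1`.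
  obtain ⟨m, hm⟩ := ENNReal.exists_nat_gt (ENNReal.div_ne_top (measure_ne_top ν univ) hvol)
  rw [ENNReal.div_lt_iff (Or.inl hvol) (Or.inl hvol')] at hm
  have hC0 : (2 * 15 ^ d : ℝ≥0∞) ≠ 0 := by simp
  have hCt : (2 * 15 ^ d : ℝ≥0∞) ≠ ∞ := by finiteness
  rw [mul_comm, ← ENNReal.div_le_iff hC0 hCt]
  refine (le_liminf_truncated_of_forall_le (measurable_maximalFun ν)
    (s₀ := (m : ℝ) + 1) (by positivity) (B := B) fun s hs => ?_).trans (liminf_le_liminf ?_)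
  · rw [ENNReal.div_le_iff hC0 hCt, mul_comm]
    have hs0 : ENNReal.ofReal s ≠ 0 := by
      have : (0 : ℝ) < (m : ℝ) + 1 := by positivity
      simpa using this.trans_le hs
    refine measure_le_mul_volume_lt_maximalFun ν hs0 ENNReal.ofReal_ne_top (ρ := ρ) ?_ _ _
      (fun x hx => ?_) fun x hx => ?_
    · refine hm.trans_le ?_
      gcongr
      have h1 : (m : ℝ≥0∞) ≤ ENNReal.ofReal s := by
        rw [← ENNReal.ofReal_natCast]
        exact ENNReal.ofReal_le_ofReal (by linarith)
      have h2 : (1 : ℝ≥0∞) ≤ 2 * 3 ^ d :=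
        one_le_mul (by norm_num) (one_le_pow₀ (by norm_num))
      calc (m : ℝ≥0∞) ≤ 1 * ENNReal.ofReal s := by rwa [one_mul]
        _ ≤ _ := by gcongr
    · refine Metric.closedBall_subset_ball' ?_
      have := Metric.mem_ball.1 hx.2
      linarith
    · exact hx.1 _ (by finiteness)
  · filter_upwards with δ
    gcongr with x
    exact maximalFun_mono hνμ x

end SliceLimits

/-! ### Measurability of the total variation in a parameter. -/

section VariationOfOpenSets

variable {d : ℕ} {F : Type*} [NormedAddCommGroup F]

/-- A countable family of open sets which is fine enough to separate a compact set from the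
complement of a neighbourhood. -/
lemma exists_countable_isOpen_separating (X : Type*) [TopologicalSpace X]
    [SecondCountableTopology X] :
    ∃ 𝒱 : Set (Set X), 𝒱.Countable ∧ (∀ V ∈ 𝒱, IsOpen V) ∧
      ∀ K W : Set X, IsCompact K → IsOpen W → K ⊆ W → ∃ V ∈ 𝒱, K ⊆ V ∧ V ⊆ W := by
  -- The family consists of the finite unions of basis elements; compactness makes these sufficient.
  set 𝒷 := TopologicalSpace.countableBasis X
  have hb := TopologicalSpace.isBasis_countableBasis X
  refine ⟨sUnion '' {S : Set (Set X) | S.Finite ∧ S ⊆ 𝒷},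
    (Set.countable_ofPred_finite_subset (TopologicalSpace.countable_countableBasis X)).image _,
    ?_, ?_⟩
  · rintro _ ⟨S, ⟨-, hS⟩, rfl⟩
    exact isOpen_sUnion fun s hs => hb.isOpen (hS hs)
  · intro K W hK hW hKW
    suffices h : ∃ S : Set (Set X), S.Finite ∧ S ⊆ 𝒷 ∧ K ⊆ ⋃₀ S ∧ ⋃₀ S ⊆ W by
      obtain ⟨S, h1, h2, h3, h4⟩ := h
      exact ⟨⋃₀ S, ⟨S, ⟨h1, h2⟩, rfl⟩, h3, h4⟩
    refine hK.induction_on (p := fun K => ∃ S : Set (Set X), S.Finite ∧ S ⊆ 𝒷 ∧ K ⊆ ⋃₀ S ∧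
      ⋃₀ S ⊆ W) ⟨∅, by simp⟩ ?_ ?_ ?_
    · rintro s t hst ⟨S, h1, h2, h3, h4⟩
      exact ⟨S, h1, h2, hst.trans h3, h4⟩
    · rintro s t ⟨S, h1, h2, h3, h4⟩ ⟨T, g1, g2, g3, g4⟩
      refine ⟨S ∪ T, h1.union g1, union_subset h2 g2, ?_, ?_⟩
      · rw [sUnion_union]
        exact union_subset_union h3 g3
      · rw [sUnion_union]
        exact union_subset h4 g4
    · intro x hx
      obtain ⟨v, hv, hxv, hvW⟩ := hb.exists_subset_of_mem_open (hKW hx) hW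
      exact ⟨v, mem_nhdsWithin_of_mem_nhds ((hb.isOpen hv).mem_nhds hxv), {v}, by simp,
        by simpa using hv, by simp, by simpa using hvW⟩

lemma enorm_le_enorm_add_variation_diff {X : Type*} [MeasurableSpace X] (D : VectorMeasure X F)
    {A B : Set X} (hA : MeasurableSet A) (hB : MeasurableSet B) (h : A ⊆ B) :
    ‖D B‖ₑ ≤ ‖D A‖ₑ + D.variation (B \ A) := by
  rw [← VectorMeasure.of_add_of_sdiff hA hB h]
  exact (enorm_add_le _ _).trans (add_le_add le_rfl (VectorMeasure.enorm_measure_le_variation _ _))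

lemma enorm_le_enorm_add_variation_diff' {X : Type*} [MeasurableSpace X] (D : VectorMeasure X F)
    {A B : Set X} (hA : MeasurableSet A) (hB : MeasurableSet B) (h : A ⊆ B) :
    ‖D A‖ₑ ≤ ‖D B‖ₑ + D.variation (B \ A) := by
  have h1 : D A = D B - D (B \ A) := by
    rw [← VectorMeasure.of_add_of_sdiff hA hB h, add_sub_cancel_right]
  rw [h1, sub_eq_add_neg]
  refine (enorm_add_le _ _).trans (add_le_add le_rfl ?_)
  rw [enorm_neg]
  exact VectorMeasure.enorm_measure_le_variation _ _

/-- A finite disjoint family of measurable subsets of an open set can be replaced by a family of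
disjoint open sets from a separating family, up to a small loss of mass. -/
lemma exists_disjoint_open_family (D : VectorMeasure (Eucl d) F) (hD : D.variation univ < ∞)
    {𝒱 : Set (Set (Eucl d))} (h𝒱o : ∀ V ∈ 𝒱, IsOpen V)
    (h𝒱 : ∀ K W : Set (Eucl d), IsCompact K → IsOpen W → K ⊆ W → ∃ V ∈ 𝒱, K ⊆ V ∧ V ⊆ W)
    {U : Set (Eucl d)} (hU : IsOpen U) (P : Finset (Set (Eucl d))) (hPU : ∀ p ∈ P, p ⊆ U)
    (hPd : (P : Set (Set (Eucl d))).PairwiseDisjoint id) (hPm : ∀ p ∈ P, MeasurableSet p)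
    {ε : ℝ≥0∞} (hε : ε ≠ 0) :
    ∃ V : Set (Eucl d) → Set (Eucl d), (∀ p ∈ P, V p ∈ 𝒱 ∧ V p ⊆ U) ∧
      (P : Set (Set (Eucl d))).PairwiseDisjoint V ∧
      ∀ p ∈ P, ‖D p‖ₑ ≤ ‖D (V p)‖ₑ + (ε + ε) := by
  have : IsFiniteMeasure D.variation := ⟨hD⟩
  -- Unlike the sets `p`, disjoint compact subsets have disjoint thickenings, and finiteness of `P`
  -- allows one common radius. One `ε` pays for `p \ K p`, the other for `V p \ K p`.
  have hK : ∀ p ∈ P, ∃ K ⊆ p, IsCompact K ∧ D.variation (p \ K) < ε := fun p hp =>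
    (hPm p hp).exists_isCompact_sdiff_lt (measure_ne_top _ _) hε
  choose! K hKp hKc hKε using hK
  have e1 : ∀ᶠ δ in 𝓝[>] (0 : ℝ), ∀ p ∈ P, Metric.thickening δ (K p) ⊆ U := by
    refine (Filter.eventually_all_finset P).2 fun p hp => ?_
    obtain ⟨δ, hδ, h⟩ := (hKc p hp).exists_thickening_subset_open hU
      ((hKp p hp).trans (hPU p hp))
    filter_upwards [Ioo_mem_nhdsGT hδ] with η hη
    exact (Metric.thickening_mono hη.2.le _).trans h
  have e2 : ∀ᶠ δ in 𝓝[>] (0 : ℝ), ∀ p ∈ P, ∀ q ∈ P, p ≠ q →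
      Disjoint (Metric.thickening δ (K p)) (Metric.thickening δ (K q)) := by
    refine (Filter.eventually_all_finset P).2 fun p hp =>
      (Filter.eventually_all_finset P).2 fun q hq => ?_
    by_cases hpq : p = q
    · exact Eventually.of_forall fun _ h => absurd hpq h
    have hdis : Disjoint (K p) (K q) := (hPd hp hq hpq).mono (hKp p hp) (hKp q hq)
    obtain ⟨δ, hδ, h⟩ := hdis.exists_thickenings (hKc p hp) (hKc q hq).isClosed
    filter_upwards [Ioo_mem_nhdsGT hδ] with η hη _
    exact h.mono (Metric.thickening_mono hη.2.le _) (Metric.thickening_mono hη.2.le _)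
  have e3 : ∀ᶠ δ in 𝓝[>] (0 : ℝ), ∀ p ∈ P,
      D.variation (Metric.thickening δ (K p)) < D.variation (K p) + ε := by
    refine (Filter.eventually_all_finset P).2 fun p hp => ?_
    exact (tendsto_measure_thickening_of_isClosed ⟨1, one_pos, measure_ne_top _ _⟩
      (hKc p hp).isClosed).eventually (gt_mem_nhds
        (ENNReal.lt_add_right (measure_ne_top _ _) hε))
  obtain ⟨δ, ⟨⟨h1, h2⟩, h3⟩, hδ⟩ := (((e1.and e2).and e3).and self_mem_nhdsWithin).exists
  have hV : ∀ p ∈ P, ∃ V ∈ 𝒱, K p ⊆ V ∧ V ⊆ Metric.thickening δ (K p) := fun p hp =>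
    h𝒱 _ _ (hKc p hp) Metric.isOpen_thickening (Metric.self_subset_thickening hδ _)
  choose! V hV𝒱 hKV hVt using hV
  refine ⟨V, fun p hp => ⟨hV𝒱 p hp, (hVt p hp).trans (h1 p hp)⟩, fun p hp q hq hpq =>
    (h2 p hp q hq hpq).mono (hVt p hp) (hVt q hq), fun p hp => ?_⟩
  have hKm := (hKc p hp).measurableSet
  have hVm := (h𝒱o _ (hV𝒱 p hp)).measurableSet
  have h4 : D.variation (V p \ K p) ≤ ε := by
    rw [measure_sdiff (hKV p hp) hKm.nullMeasurableSet (measure_ne_top _ _)]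
    exact tsub_le_iff_left.2 ((measure_mono (hVt p hp)).trans (h3 p hp).le)
  calc ‖D p‖ₑ ≤ ‖D (K p)‖ₑ + D.variation (p \ K p) :=
        enorm_le_enorm_add_variation_diff D hKm (hPm p hp) (hKp p hp)
    _ ≤ (‖D (V p)‖ₑ + ε) + ε := by
        refine add_le_add ((enorm_le_enorm_add_variation_diff' D hKm hVm (hKV p hp)).trans ?_)
          (hKε p hp).le
        gcongr
    _ = _ := add_assoc _ _ _

/-- The total variation of open sets is a supremum over a countable collection of finite
families of open sets, the same for all vector measures of finite variation. -/
lemma variation_eq_iSup_of_isOpen (D : VectorMeasure (Eucl d) F) (hD : D.variation univ < ∞)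
    {𝒱 : Set (Set (Eucl d))} (h𝒱o : ∀ V ∈ 𝒱, IsOpen V)
    (h𝒱 : ∀ K W : Set (Eucl d), IsCompact K → IsOpen W → K ⊆ W → ∃ V ∈ 𝒱, K ⊆ V ∧ V ⊆ W)
    {U : Set (Eucl d)} (hU : IsOpen U) :
    D.variation U = ⨆ P ∈ {P : Finset (Set (Eucl d)) | (P : Set (Set (Eucl d))) ⊆ 𝒱 ∧
      (∀ p ∈ P, p ⊆ U) ∧ (P : Set (Set (Eucl d))).PairwiseDisjoint id}, ∑ p ∈ P, ‖D p‖ₑ := by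
  classical
  refine le_antisymm (le_of_forall_lt fun a ha => ?_)
    (iSup₂_le fun P hP => D.le_variation hU.measurableSet hP.2.1 hP.2.2)
  obtain ⟨P, hPU, hPd, hPm, haP⟩ := D.exists_lt_sum_of_lt_variation hU.measurableSet ha
  refine haP.trans_le (ENNReal.le_of_forall_pos_le_add fun ε hε _ => ?_)
  -- The added 1 keeps `N` positive when `P` is empty; the 2 in `ε / (2 * N)` offsets the double
  -- loss per set.
  set N : ℝ≥0 := P.card + 1
  have hN : 0 < N := by positivity
  obtain ⟨V, hV, hVd, hDV⟩ := exists_disjoint_open_family D hD h𝒱o h𝒱 hU P hPU hPd hPm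
    (ε := ((ε / (2 * N) : ℝ≥0) : ℝ≥0∞)) (by
      have : 0 < ε / (2 * N) := by positivity
      exact_mod_cast this.ne')
  calc ∑ p ∈ P, ‖D p‖ₑ ≤ ∑ p ∈ P, (‖D (V p)‖ₑ +
        (((ε / (2 * N) : ℝ≥0) : ℝ≥0∞) + ((ε / (2 * N) : ℝ≥0) : ℝ≥0∞))) :=
        Finset.sum_le_sum hDV
    _ = ∑ p ∈ P, ‖D (V p)‖ₑ + ((P.card * (ε / (2 * N) + ε / (2 * N)) : ℝ≥0) : ℝ≥0∞) := by
        rw [Finset.sum_add_distrib]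
        simp [mul_add]
    _ ≤ ∑ p ∈ P, ‖D (V p)‖ₑ + ε := by
        gcongr
        have h1 : (P.card : ℝ≥0) ≤ N := le_self_add
        calc (P.card * (ε / (2 * N) + ε / (2 * N)) : ℝ≥0)
            ≤ N * (ε / (2 * N) + ε / (2 * N)) := by gcongr
          _ = ε := by field_simp; norm_num
    _ = ∑ p ∈ P.image V, ‖D p‖ₑ + ε := by
        -- `V` may fail to be injective only where its value is empty, and there `D` vanishes.
        rw [Finset.sum_image_of_disjoint (g := fun p => ‖D p‖ₑ) (by simp) hVd]
    _ ≤ _ := by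
        gcongr
        refine le_iSup₂ (f := fun (P : Finset (Set (Eucl d)))
          (_ : P ∈ {P : Finset (Set (Eucl d)) | (P : Set (Set (Eucl d))) ⊆ 𝒱 ∧
            (∀ p ∈ P, p ⊆ U) ∧ (P : Set (Set (Eucl d))).PairwiseDisjoint id}) =>
          ∑ p ∈ P, ‖D p‖ₑ) (P.image V) ⟨?_, ?_, ?_⟩
        · intro v hv
          obtain ⟨p, hp, rfl⟩ := Finset.mem_image.1 hv
          exact (hV p hp).1
        · intro v hv
          obtain ⟨p, hp, rfl⟩ := Finset.mem_image.1 hv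
          exact (hV p hp).2
        · intro v hv w hw hvw
          obtain ⟨p, hp, rfl⟩ := Finset.mem_image.1 hv
          obtain ⟨q, hq, rfl⟩ := Finset.mem_image.1 hw
          exact hVd hp hq fun h => hvw (by rw [h])

/-- If a parametrized vector measure of finite variation is measurable in the parameter on open
sets, then so is its total variation. -/
lemma measurable_variation {T : Type*} [MeasurableSpace T] [MeasurableSpace F] [BorelSpace F]
    (D : T → VectorMeasure (Eucl d) F)
    (hD : ∀ t, (D t).variation univ < ∞)
    (hm : ∀ V : Set (Eucl d), IsOpen V → Measurable fun t => D t V) :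
    Measurable fun t => (D t).variation := by
  have : ∀ t, IsFiniteMeasure (D t).variation := fun t => ⟨hD t⟩
  obtain ⟨𝒱, h𝒱c, h𝒱o, h𝒱⟩ := exists_countable_isOpen_separating (Eucl d)
  have key : ∀ U : Set (Eucl d), IsOpen U → Measurable fun t => (D t).variation U := by
    intro U hU
    simp_rw [fun t => variation_eq_iSup_of_isOpen (D t) (hD t) h𝒱o h𝒱 hU]
    refine Measurable.biSup _ ?_ fun P hP => ?_
    · refine Set.Countable.mono (s₂ := {P : Finset (Set (Eucl d)) |
        (P : Set (Set (Eucl d))) ⊆ 𝒱}) (fun P hP => hP.1) ?_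
      refine Set.Countable.mono (fun P hP => ?_)
        ((Set.countable_ofPred_finite_subset h𝒱c).preimage Finset.coe_injective)
      exact ⟨P.finite_toSet, hP⟩
    · exact Finset.measurable_fun_sum P fun p hp => (hm p (h𝒱o p (hP.1 hp))).enorm
  refine Measurable.measure_of_isPiSystem (S := {s | IsOpen s}) BorelSpace.measurable_eq
    isPiSystem_isOpen key (key univ isOpen_univ)

end VariationOfOpenSets

/-! ### Joint measurability of the maximal function in time and space. -/

section MeasurableMaximalFunction

variable {d : ℕ}

/-- A ball is the directed union of concentric balls of smaller rational radius, whose volumes are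
smaller too. The supremum becomes countable. -/
lemma maximalFun_eq_iSup_rat (μ : Measure (Eucl d)) (x : Eucl d) :
    maximalFun μ x = ⨆ (q : ℚ) (_ : 0 < q),
      μ (Metric.ball x q) / volume (Metric.ball (0 : Eucl d) q) := by
  refine le_antisymm (le_of_forall_lt fun l hl => ?_) (iSup₂_le fun q hq => ?_)
  · obtain ⟨r, hr, h⟩ := (lt_maximalFun_iff μ x l).1 hl
    have hU : Metric.ball x r = ⋃ q : {q : ℚ // 0 < q ∧ (q : ℝ) < r}, Metric.ball x (q : ℚ) := by
      ext y
      simp only [mem_iUnion, Metric.mem_ball, Subtype.exists, exists_prop]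
      constructor
      · intro hy
        obtain ⟨q, hq1, hq2⟩ := exists_rat_btwn hy
        exact ⟨q, ⟨by exact_mod_cast dist_nonneg.trans_lt hq1, hq2⟩, hq1⟩
      · rintro ⟨q, ⟨-, hq⟩, hy⟩
        exact hy.trans hq
    have hdir : Directed (· ⊆ ·) fun q : {q : ℚ // 0 < q ∧ (q : ℝ) < r} =>
        Metric.ball x (q : ℚ) := by
      refine directed_of_isDirected_le fun p q hpq => Metric.ball_subset_ball ?_
      exact_mod_cast hpq
    have hμ : μ (Metric.ball x r) = ⨆ q : {q : ℚ // 0 < q ∧ (q : ℝ) < r},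
        μ (Metric.ball x (q : ℚ)) := by rw [hU, hdir.measure_iUnion]
    rw [hμ, lt_iSup_iff] at h
    obtain ⟨⟨q, hq0, hqr⟩, hq⟩ := h
    have hq0' : (0 : ℝ) < q := by exact_mod_cast hq0
    refine lt_of_lt_of_le ?_ (le_iSup₂ (f := fun (q : ℚ) (_ : 0 < q) =>
      μ (Metric.ball x q) / volume (Metric.ball (0 : Eucl d) q)) q hq0)
    rw [ENNReal.lt_div_iff_mul_lt (Or.inl (volume_ball_pos _ hq0'))
      (Or.inl (volume_ball_ne_top _ _))]
    refine lt_of_le_of_lt ?_ hq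
    rw [← Measure.addHaar_ball_center volume x]
    gcongr
  · rw [← Measure.addHaar_ball_center volume x]
    exact le_maximalFun μ x (by exact_mod_cast hq)

lemma measurable_maximalFun_prod {T : Type*} [MeasurableSpace T] {κ : T → Measure (Eucl d)}
    (hκ : Measurable κ) (hfin : ∀ t, IsFiniteMeasure (κ t)) :
    Measurable fun p : T × Eucl d => maximalFun (κ p.1) p.2 := by
  simp_rw [maximalFun_eq_iSup_rat]
  refine Measurable.iSup fun q => Measurable.iSup fun _ => Measurable.div_const ?_ _
  let η : ProbabilityTheory.Kernel T (Eucl d) := ⟨κ, hκ⟩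
  have hs : MeasurableSet {z : (T × Eucl d) × Eucl d | dist z.2 z.1.2 < (q : ℝ)} :=
    measurableSet_lt (by fun_prop) measurable_const
  -- The balls are sections of one measurable set, measured by the kernel pulled back along the
  -- first projection.
  exact ProbabilityTheory.Kernel.measurable_kernel_prodMk_left_of_finite
    (κ := ProbabilityTheory.Kernel.comap η (Prod.fst : T × Eucl d → T) measurable_fst) hs
    fun p => hfin p.1

end MeasurableMaximalFunction

/-! ### Distributional derivatives of time slices and their measurability. -/

section DerivMeasure

variable {d : ℕ}

lemma isDerivMeasure_derivMeasure {f : Eucl d → Eucl d} (h : ∃ D, IsDerivMeasure f D) :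
    IsDerivMeasure f (derivMeasure f) := by
  rw [derivMeasure, dif_pos h]
  exact h.choose_spec

lemma variation_derivMeasure_univ_lt_top (f : Eucl d → Eucl d) :
    (derivMeasure f).variation univ < ∞ := by
  by_cases h : ∃ D, IsDerivMeasure f D
  · exact (isDerivMeasure_derivMeasure h).1
  · rw [derivMeasure, dif_neg h]
    simp

instance isFiniteMeasure_variation_derivMeasure (f : Eucl d → Eucl d) :
    IsFiniteMeasure (derivMeasure f).variation :=
  ⟨variation_derivMeasure_univ_lt_top f⟩

instance isFiniteMeasure_derivVar (f : Eucl d → Eucl d) : IsFiniteMeasure (derivVar f) :=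
  ⟨variation_derivMeasure_univ_lt_top f⟩

/-- The choice depends only on the predicate `IsDerivMeasure f`, which is the same for both
functions; uniqueness of the derivative is not needed. -/
lemma derivMeasure_congr_ae {f g : Eucl d → Eucl d} (h : f =ᵐ[volume] g) :
    derivMeasure f = derivMeasure g := by
  have hfg : IsDerivMeasure f = IsDerivMeasure g := by
    ext D
    simp only [IsDerivMeasure]
    refine and_congr_right fun _ => forall₄_congr fun φ _ i j => ?_
    have : ∫ x, f x i * partialDeriv j φ x = ∫ x, g x i * partialDeriv j φ x :=
      integral_congr_ae (by filter_upwards [h] with x hx; rw [hx])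
    rw [this]
  unfold derivMeasure
  generalize IsDerivMeasure f = P at hfg
  subst hfg
  rfl

lemma IsTestFun.continuous_partialDeriv {φ : Eucl d → ℝ} (hφ : IsTestFun φ) (j : Fin d) :
    Continuous (partialDeriv j φ) :=
  (hφ.1.continuous_fderiv (by simp)).clm_apply continuous_const

/-- The indicator function of an open set is a bounded limit of test functions. -/
lemma exists_testFun_tendsto_indicator {V : Set (Eucl d)} (hV : IsOpen V) :
    ∃ φ : ℕ → Eucl d → ℝ, (∀ n, IsTestFun (φ n)) ∧ (∀ n x, ‖φ n x‖ ≤ V.indicator 1 x) ∧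
      ∀ x, Tendsto (fun n => φ n x) atTop (𝓝 (V.indicator 1 x)) := by
  obtain ⟨f, hfV, hf, hf01⟩ := hV.exists_contDiff_support_eq (n := ⊤)
  let χ : ℕ → ContDiffBump (0 : Eucl d) := fun n => ⟨(n : ℝ) + 1, n + 2, by positivity, by linarith⟩
  have hf0 : ∀ x, 0 ≤ f x := fun x => (hf01 (mem_range_self x)).1
  have hfx : ∀ x, x ∉ V → f x = 0 := fun x hx => by
    rw [← hfV] at hx
    exact Function.notMem_support.1 hx
  -- As `f` is positive exactly on `V`, the first factor equals 1 once `n * f x ≥ 1` and is 0 off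
  -- `V`; the bump gives compact support when `V` is unbounded.
  refine ⟨fun n x => Real.smoothTransition (n * f x) * χ n x, fun n => ⟨?_, ?_⟩, fun n x => ?_,
    fun x => ?_⟩
  · exact (Real.smoothTransition.contDiff.comp (contDiff_const.mul hf)).mul (χ n).contDiff
  · exact (χ n).hasCompactSupport.mul_left
  · rw [Real.norm_eq_abs, abs_of_nonneg (mul_nonneg (Real.smoothTransition.nonneg _) (χ n).nonneg)]
    by_cases hx : x ∈ V
    · rw [indicator_of_mem hx]
      exact mul_le_one₀ (Real.smoothTransition.le_one _) (χ n).nonneg (χ n).le_one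
    · rw [indicator_of_notMem hx, hfx x hx]
      simp
  · by_cases hx : x ∈ V
    · rw [indicator_of_mem hx]
      have hpos : 0 < f x := lt_of_le_of_ne (hf0 x) fun h => by
        rw [← hfV] at hx
        exact hx h.symm
      obtain ⟨m, hm⟩ := exists_nat_ge (1 / f x)
      obtain ⟨k, hk⟩ := exists_nat_ge ‖x‖
      refine tendsto_const_nhds.congr' ?_
      filter_upwards [eventually_ge_atTop m, eventually_ge_atTop k] with n hnm hnk
      have h1 : 1 ≤ n * f x := by
        rw [div_le_iff₀ hpos] at hm
        exact hm.trans (by gcongr)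
      have h2 : χ n x = 1 := (χ n).one_of_mem_closedBall (by
        simp only [Metric.mem_closedBall, dist_zero_right, χ]
        have : (k : ℝ) ≤ n := by exact_mod_cast hnk
        linarith)
      simp [Real.smoothTransition.one_of_one_le h1, h2]
    · rw [indicator_of_notMem hx]
      simp [hfx x hx]

lemma tendsto_vectorIntegral_indicator {F : Type*} [NormedAddCommGroup F] [NormedSpace ℝ F]
    [CompleteSpace F] (D : VectorMeasure (Eucl d) F)
    [IsFiniteMeasure D.variation] {V : Set (Eucl d)} (hV : MeasurableSet V)
    {φ : ℕ → Eucl d → ℝ} (hφ : ∀ n, IsTestFun (φ n)) (hb : ∀ n x, ‖φ n x‖ ≤ V.indicator 1 x)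
    (hlim : ∀ x, Tendsto (fun n => φ n x) atTop (𝓝 (V.indicator 1 x))) :
    Tendsto (fun n => ∫ᵛ x, φ n x ∂•D) atTop (𝓝 (D V)) := by
  have h1 : ∫ᵛ x, V.indicator (fun _ => (1 : ℝ)) x ∂•D = D V := by
    rw [VectorMeasure.integral_indicator_const (1 : ℝ) hV]
    simp
  rw [← h1]
  refine VectorMeasure.tendsto_integral_filter_of_norm_le_const
    (Eventually.of_forall fun n => (hφ n).1.continuous.aestronglyMeasurable)
    ⟨1, Eventually.of_forall fun n => ae_of_all _ fun x => (hb n x).trans ?_⟩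
    (ae_of_all _ hlim)
  exact indicator_le_self' (fun _ _ => zero_le_one) x

/-- The value on `V` is a limit of integrals of test functions, which integration by parts turns
into integrals of `c t`; these are measurable in `t`. -/
lemma measurable_derivMeasure_apply {T : Type*} [MeasurableSpace T] {c : T → Eucl d → Eucl d}
    (hc : StronglyMeasurable fun p : T × Eucl d => c p.1 p.2)
    (h : ∀ t, ∃ D, IsDerivMeasure (c t) D) {V : Set (Eucl d)} (hV : IsOpen V) :
    Measurable fun t => derivMeasure (c t) V := by
  obtain ⟨φ, hφ, hb, hlim⟩ := exists_testFun_tendsto_indicator hV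
  refine measurable_of_tendsto_metrizable (f := fun n t => ∫ᵛ x, φ n x ∂•(derivMeasure (c t)))
    (fun n => ?_) (tendsto_pi_nhds.2 fun t =>
      tendsto_vectorIntegral_indicator _ hV.measurableSet hφ hb hlim)
  have hcoord : ∀ t, ∫ᵛ x, φ n x ∂•(derivMeasure (c t)) =
      WithLp.toLp 2 fun ij : Fin d × Fin d => -∫ x, c t x ij.1 * partialDeriv ij.2 (φ n) x :=
    fun t => by
      ext ij
      simp only
      rw [(isDerivMeasure_derivMeasure (h t)).2 (φ n) (hφ n) ij.1 ij.2, neg_neg]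
  simp_rw [hcoord]
  refine (WithLp.measurable_toLp 2 _).comp (measurable_pi_iff.2 fun ij => ?_)
  refine (StronglyMeasurable.integral_prod_right (f := fun t x =>
    c t x ij.1 * partialDeriv ij.2 (φ n) x) ?_).measurable.neg
  exact ((PiLp.continuous_apply 2 _ ij.1).comp_stronglyMeasurable hc).mul
    (((hφ n).continuous_partialDeriv ij.2).stronglyMeasurable.comp_measurable measurable_snd)

lemma measurable_derivVar {T : Type*} [MeasurableSpace T] {c : T → Eucl d → Eucl d}
    (hc : StronglyMeasurable fun p : T × Eucl d => c p.1 p.2)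
    (h : ∀ t, ∃ D, IsDerivMeasure (c t) D) :
    Measurable fun t => derivVar (c t) :=
  measurable_variation _ (fun t => variation_derivMeasure_univ_lt_top (c t))
    fun _ hV => measurable_derivMeasure_apply hc h hV

/-- A vector field in `L¹(BV)` has a jointly measurable representative all of whose time slices
have a measure as distributional derivative. -/
lemma MemL1BV.exists_measurable_representative {T : ℝ≥0∞} {b : ℝ → Eucl d → Eucl d}
    (hb : MemL1BV T b) :
    ∃ c : ℝ → Eucl d → Eucl d, StronglyMeasurable (fun p : ℝ × Eucl d => c p.1 p.2) ∧
      (∀ t, ∃ D, IsDerivMeasure (c t) D) ∧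
      ∀ᵐ t ∂(volume.restrict (timeInterval T)), c t =ᵐ[volume] b t := by
  obtain ⟨hm, hBV, -⟩ := hb
  have hae : ∀ᵐ t ∂(volume.restrict (timeInterval T)), (∃ D, IsDerivMeasure (b t) D) ∧
      ∀ᵐ x, b t x = hm.mk _ (t, x) := by
    filter_upwards [hBV, Measure.ae_ae_of_ae_prod hm.ae_eq_mk] with t h1 h2
    exact ⟨h1.2, h2⟩
  -- A measurable null hull of the bad times; there the representative is set to 0, with derivative
  -- 0.
  set S := toMeasurable (volume.restrict (timeInterval T))
    {t | ¬ ((∃ D, IsDerivMeasure (b t) D) ∧ ∀ᵐ x, b t x = hm.mk _ (t, x))} with hS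
  have hSm : MeasurableSet S := measurableSet_toMeasurable _ _
  have hS0 : volume.restrict (timeInterval T) S = 0 := by
    rw [hS, measure_toMeasurable]
    exact hae
  have hSc : ∀ t, t ∉ S → (∃ D, IsDerivMeasure (b t) D) ∧ ∀ᵐ x, b t x = hm.mk _ (t, x) :=
    fun t ht => not_not.1 fun h => ht (subset_toMeasurable _ _ h)
  refine ⟨fun t x => (Prod.fst ⁻¹' Sᶜ : Set (ℝ × Eucl d)).indicator (hm.mk _) (t, x),
    hm.stronglyMeasurable_mk.indicator (measurable_fst hSm.compl), fun t => ?_, ?_⟩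
  · by_cases ht : t ∈ S
    · refine ⟨0, by simp, fun φ _ i j => ?_⟩
      have h0 : ∀ x : Eucl d, (t, x) ∉ (Prod.fst ⁻¹' Sᶜ : Set (ℝ × Eucl d)) := fun x h => h ht
      simp only [indicator_of_notMem (h0 _)]
      simp
    · obtain ⟨⟨D, hD1, hD2⟩, hbt⟩ := hSc t ht
      refine ⟨D, hD1, fun φ hφ i j => ?_⟩
      rw [← hD2 φ hφ i j]
      refine integral_congr_ae ?_
      filter_upwards [hbt] with x hx
      rw [indicator_of_mem (show (t, x) ∈ (Prod.fst ⁻¹' Sᶜ : Set (ℝ × Eucl d)) from ht), hx]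
  · have : ∀ᵐ t ∂(volume.restrict (timeInterval T)), t ∉ S := measure_eq_zero_iff_ae_notMem.1 hS0
    filter_upwards [this] with t ht
    filter_upwards [(hSc t ht).2] with x hx
    rw [indicator_of_mem (show (t, x) ∈ (Prod.fst ⁻¹' Sᶜ : Set (ℝ × Eucl d)) from ht), hx]

end DerivMeasure

/-! ### Vector measures with an integrable density. -/

section Density

/-- True for simple functions by linearity, then for bounded `φ` by dominated convergence on both
sides. -/
lemma vectorIntegral_eq_integral_smul_density {X F : Type*} [MeasurableSpace X]
    [NormedAddCommGroup F] [NormedSpace ℝ F] [CompleteSpace F] {D : VectorMeasure X F}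
    [IsFiniteMeasure D.variation] {μ : Measure X} {g : X → F} (hg : Integrable g μ)
    (hD : ∀ A, MeasurableSet A → D A = ∫ x in A, g x ∂μ) {φ : X → ℝ}
    (hφ : StronglyMeasurable φ) {C : ℝ} (hC : ∀ x, ‖φ x‖ ≤ C) :
    ∫ᵛ x, φ x ∂•D = ∫ x, φ x • g x ∂μ := by
  have hsint : ∀ s : SimpleFunc X ℝ, Integrable (fun x => s x • g x) μ := fun s => by
    obtain ⟨c, hc⟩ := s.exists_forall_norm_le
    exact hg.bdd_smul c s.stronglyMeasurable.aestronglyMeasurable (ae_of_all _ hc)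
  have hs : ∀ s : SimpleFunc X ℝ, ∫ᵛ x, s x ∂•D = ∫ x, s x • g x ∂μ := by
    intro s
    induction s using SimpleFunc.induction with
    | const c hA =>
      rename_i A
      have h1 : ⇑(SimpleFunc.piecewise A hA (SimpleFunc.const X c) (SimpleFunc.const X 0)) =
          A.indicator fun _ => c := by
        ext x
        by_cases hx : x ∈ A <;> simp [hx]
      rw [h1, VectorMeasure.integral_indicator_const c hA, hD A hA]
      have h2 : ∀ x, A.indicator (fun _ => c) x • g x = A.indicator (fun x => c • g x) x :=
        fun x => by by_cases hx : x ∈ A <;> simp [hx]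
      simp_rw [h2]
      rw [integral_indicator hA, integral_smul]
      simp
    | add _ hf hh =>
      rename_i f h _
      have h1 : ∫ᵛ x, (f + h) x ∂•D = ∫ᵛ x, f x ∂•D + ∫ᵛ x, h x ∂•D :=
        VectorMeasure.integral_fun_add (SimpleFunc.integrable_of_isFiniteMeasure f)
          (SimpleFunc.integrable_of_isFiniteMeasure h)
      have h2 : ∫ x, (f + h) x • g x ∂μ = ∫ x, f x • g x ∂μ + ∫ x, h x • g x ∂μ := by
        rw [← integral_add (hsint f) (hsint h)]
        exact integral_congr_ae (ae_of_all _ fun x => add_smul (f x) (h x) (g x))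
      rw [h1, hf, hh, h2]
  rcases isEmpty_or_nonempty X with hX | ⟨⟨x₀⟩⟩
  · rw [VectorMeasure.integral_of_isEmpty, integral_of_isEmpty]
  have hC0 : 0 ≤ C := (norm_nonneg _).trans (hC x₀)
  have hlim : ∀ x, Tendsto (fun n => hφ.approxBounded C n x) atTop (𝓝 (φ x)) := fun x =>
    hφ.tendsto_approxBounded_of_norm_le (hC x)
  have h1 : Tendsto (fun n => ∫ᵛ x, hφ.approxBounded C n x ∂•D) atTop (𝓝 (∫ᵛ x, φ x ∂•D)) :=
    VectorMeasure.tendsto_integral_filter_of_norm_le_const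
      (Eventually.of_forall fun n => (SimpleFunc.stronglyMeasurable _).aestronglyMeasurable)
      ⟨C, Eventually.of_forall fun n => ae_of_all _ (hφ.norm_approxBounded_le hC0 n)⟩
      (ae_of_all _ hlim)
  have h2 : Tendsto (fun n => ∫ x, hφ.approxBounded C n x • g x ∂μ) atTop
      (𝓝 (∫ x, φ x • g x ∂μ)) := by
    refine tendsto_integral_of_dominated_convergence (fun x => C * ‖g x‖)
      (fun n => (hsint _).aestronglyMeasurable) (hg.norm.const_mul C)
      (fun n => ae_of_all _ fun x => ?_) (ae_of_all _ fun x => (hlim x).smul_const _)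
    rw [norm_smul]
    gcongr
    exact hφ.norm_approxBounded_le hC0 n x
  simp_rw [hs] at h1
  exact tendsto_nhds_unique h1 h2

/-- A signed measure with an integrable density controls the integral of the density. -/
lemma lintegral_enorm_le_of_forall_setIntegral_le {X : Type*} [MeasurableSpace X] {μ : Measure X}
    {g : X → ℝ} (hg : Integrable g μ) (hgm : Measurable g) {K : ℝ≥0∞}
    (h : ∀ A, MeasurableSet A → ‖∫ x in A, g x ∂μ‖ₑ ≤ K) :
    ∫⁻ x, ‖g x‖ₑ ∂μ ≤ 2 * K := by
  have hA : MeasurableSet {x | 0 ≤ g x} := measurableSet_le measurable_const hgm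
  rw [← lintegral_add_compl _ hA, two_mul]
  refine add_le_add ?_ ?_
  · refine le_trans (le_of_eq ?_) (h _ hA)
    rw [Real.enorm_of_nonneg (setIntegral_nonneg hA fun x hx => hx),
      ofReal_integral_eq_lintegral_ofReal hg.integrableOn ((ae_restrict_iff' hA).2 (ae_of_all _
        fun x hx => hx))]
    exact setLIntegral_congr_fun hA fun x hx => Real.enorm_of_nonneg hx
  · refine le_trans (le_of_eq ?_) (h _ hA.compl)
    have hneg : ∀ x ∈ {x | 0 ≤ g x}ᶜ, 0 ≤ -g x := fun x hx =>
      neg_nonneg.2 (not_le.1 (show ¬ 0 ≤ g x from hx)).le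
    rw [← enorm_neg, ← integral_neg, Real.enorm_of_nonneg (setIntegral_nonneg hA.compl hneg),
      ofReal_integral_eq_lintegral_ofReal (f := fun x => -g x) hg.neg.integrableOn ((ae_restrict_iff' hA.compl).2
        (ae_of_all _ hneg))]
    exact setLIntegral_congr_fun hA.compl fun x hx => by
      rw [← enorm_neg]
      exact Real.enorm_of_nonneg (hneg x hx)

/-- Radon–Nikodym in each coordinate. The factor 2 comes from splitting a coordinate by sign, the
cardinality from summing over coordinates. -/
lemma exists_density_of_absolutelyContinuous {X ι : Type*} [MeasurableSpace X] [Fintype ι]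
    (D : VectorMeasure X (EuclideanSpace ℝ ι)) {μ : Measure X} [SigmaFinite μ]
    (hac : D.variation ≪ μ) :
    ∃ g : X → EuclideanSpace ℝ ι, Integrable g μ ∧
      (∀ A, MeasurableSet A → D A = ∫ x in A, g x ∂μ) ∧
      ∫⁻ x, ‖g x‖ₑ ∂μ ≤ Fintype.card ι * (2 * D.variation univ) := by
  let π : ι → EuclideanSpace ℝ ι →L[ℝ] ℝ := fun k => EuclideanSpace.proj k
  let s : ι → SignedMeasure X := fun k => D.mapRange (π k : _ →+ ℝ) (π k).continuous
  have hs : ∀ k A, s k A = D A k := fun k A => rfl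
  have hsac : ∀ k, s k ≪ᵥ μ.toENNRealVectorMeasure := fun k => by
    refine VectorMeasure.AbsolutelyContinuous.mk fun A hA h0 => ?_
    rw [Measure.toENNRealVectorMeasure_apply_measurable hA] at h0
    rw [hs, ((D.variation_apply_eq_zero hA).1 (hac h0) A subset_rfl hA)]
    rfl
  have hint : ∀ k, Integrable ((s k).rnDeriv μ) μ := fun k => (s k).integrable_rnDeriv μ
  have hset : ∀ k A, MeasurableSet A → ∫ x in A, (s k).rnDeriv μ x ∂μ = D A k :=
    fun k A hA => by
      rw [← withDensityᵥ_apply (hint k) hA, (s k).withDensityᵥ_rnDeriv_eq μ (hsac k), hs]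
  let g : X → EuclideanSpace ℝ ι := fun x => WithLp.toLp 2 fun k => (s k).rnDeriv μ x
  have hg : Integrable g μ := Integrable.of_eval_piLp hint
  refine ⟨g, hg, fun A hA => ?_, ?_⟩
  · ext k
    rw [eval_integral_piLp (f := g) fun k => (hint k).integrableOn]
    exact (hset k A hA).symm
  · calc ∫⁻ x, ‖g x‖ₑ ∂μ ≤ ∫⁻ x, ∑ k, ‖(s k).rnDeriv μ x‖ₑ ∂μ := by
          refine lintegral_mono fun x => ?_
          classical
          have h1 : g x = ∑ k, EuclideanSpace.single k ((s k).rnDeriv μ x) := by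
            ext j
            simp [g, Finset.sum_apply, Pi.single_apply]
          rw [h1]
          refine (enorm_sum_le _ _).trans (Finset.sum_le_sum fun k _ => le_of_eq ?_)
          rw [enorm_eq_nnnorm, enorm_eq_nnnorm, PiLp.nnnorm_single]
      _ = ∑ k, ∫⁻ x, ‖(s k).rnDeriv μ x‖ₑ ∂μ :=
          lintegral_finsetSum _ fun k _ => ((s k).measurable_rnDeriv μ).enorm
      _ ≤ ∑ k : ι, 2 * D.variation univ := by
          refine Finset.sum_le_sum fun k _ => lintegral_enorm_le_of_forall_setIntegral_le (hint k)
            ((s k).measurable_rnDeriv μ) fun A hA => ?_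
          rw [hset k A hA]
          calc ‖D A k‖ₑ ≤ ‖D A‖ₑ := by
                rw [enorm_le_iff_norm_le]
                exact PiLp.norm_apply_le _ _
            _ ≤ D.variation univ := (VectorMeasure.enorm_measure_le_variation _ _).trans
                (measure_mono (subset_univ _))
      _ = _ := by simp

end Density

/-! ### Absolutely continuous derivatives and weak gradients. -/

section WeakGradient

variable {d : ℕ}

/-- `D` and `G` have the same integrals against test functions, and these approximate the indicator
of `V`. Boundedness of `V` makes `G` integrable there. -/
lemma IsDerivMeasure.apply_eq_setIntegral {f : Eucl d → Eucl d}
    {D : VectorMeasure (Eucl d) (EuclMat d)} (hD : IsDerivMeasure f D) {G : Eucl d → EuclMat d}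
    (hG : IsWeakGrad f G) {V : Set (Eucl d)} (hV : IsOpen V) (hVb : Bornology.IsBounded V)
    (ij : Fin d × Fin d) : D V ij = ∫ x in V, G x ij := by
  have : IsFiniteMeasure D.variation := ⟨hD.1⟩
  obtain ⟨φ, hφ, hb, hlim⟩ := exists_testFun_tendsto_indicator hV
  have h1 : Tendsto (fun n => (∫ᵛ x, φ n x ∂•D) ij) atTop (𝓝 (D V ij)) :=
    ((PiLp.continuous_apply 2 _ ij).tendsto _).comp
      (tendsto_vectorIntegral_indicator D hV.measurableSet hφ hb hlim)
  have h2 : ∀ n, (∫ᵛ x, φ n x ∂•D) ij = ∫ x, φ n x * G x ij := fun n => by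
    have e1 := hD.2 (φ n) (hφ n) ij.1 ij.2
    have e2 := hG.2.2 (φ n) (hφ n) ij.1 ij.2
    rw [e1] at e2
    exact neg_injective e2
  have hGV : IntegrableOn G V := (hG.2.1.integrableOn_isCompact hVb.isCompact_closure).mono_set
    subset_closure
  have hGij : IntegrableOn (fun x => G x ij) V := Integrable.eval_piLp hGV ij
  have hGm : AEStronglyMeasurable (fun x => G x ij) volume :=
    (PiLp.continuous_apply 2 _ ij).comp_aestronglyMeasurable hG.2.1.aestronglyMeasurable
  have h3 : Tendsto (fun n => ∫ x, φ n x * G x ij) atTop (𝓝 (∫ x, V.indicator 1 x * G x ij)) := by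
    refine tendsto_integral_of_dominated_convergence (V.indicator fun x => ‖G x ij‖)
      (fun n => (hφ n).1.continuous.aestronglyMeasurable.mul hGm)
      ((integrable_indicator_iff hV.measurableSet).2 hGij.norm)
      (fun n => ae_of_all _ fun x => ?_) (ae_of_all _ fun x => (hlim x).mul_const _)
    rw [norm_mul]
    refine (mul_le_mul_of_nonneg_right (hb n x) (norm_nonneg _)).trans (le_of_eq ?_)
    by_cases hx : x ∈ V <;> simp [hx]
  simp_rw [h2] at h1
  rw [tendsto_nhds_unique h1 h3, ← integral_indicator hV.measurableSet]
  congr 1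
  ext x
  by_cases hx : x ∈ V <;> simp [hx]

/-- On shrinking neighbourhoods `U δ` of `K`, `D (U δ)` is an integral of `G` tending to 0, because
`K` is null, and the variation of `U δ \ K` tends to 0. -/
lemma IsDerivMeasure.apply_eq_zero_of_isCompact {f : Eucl d → Eucl d}
    {D : VectorMeasure (Eucl d) (EuclMat d)} (hD : IsDerivMeasure f D) {G : Eucl d → EuclMat d}
    (hG : IsWeakGrad f G) {K : Set (Eucl d)} (hK : IsCompact K) (hK0 : volume K = 0) :
    D K = 0 := by
  have : IsFiniteMeasure D.variation := ⟨hD.1⟩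
  ext ij
  set ν := (volume : Measure (Eucl d)).withDensity fun x => ‖G x ij‖ₑ
  set U : ℝ → Set (Eucl d) := fun δ => Metric.thickening δ K
  have hUo : ∀ δ, IsOpen (U δ) := fun δ => Metric.isOpen_thickening
  have hUb : ∀ δ, Bornology.IsBounded (U δ) := fun δ => hK.isBounded.thickening
  have hν : ∀ δ, ν (U δ) ≠ ∞ := fun δ => by
    have hGV : IntegrableOn G (U δ) :=
      (hG.2.1.integrableOn_isCompact (hUb δ).isCompact_closure).mono_set subset_closure
    rw [withDensity_apply _ (hUo δ).measurableSet]
    exact (Integrable.eval_piLp hGV ij).2.ne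
  have l1 : Tendsto (fun δ => ν (U δ)) (𝓝[>] 0) (𝓝 0) := by
    rw [← withDensity_absolutelyContinuous (volume : Measure (Eucl d)) (fun x => ‖G x ij‖ₑ) hK0]
    exact tendsto_measure_thickening_of_isClosed ⟨1, one_pos, hν 1⟩ hK.isClosed
  have l2 : Tendsto (fun δ => D.variation (U δ) - D.variation K) (𝓝[>] 0) (𝓝 0) := by
    rw [← tsub_self (D.variation K)]
    exact ENNReal.Tendsto.sub (tendsto_measure_thickening_of_isClosed
      ⟨1, one_pos, measure_ne_top _ _⟩ hK.isClosed) tendsto_const_nhds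
      (Or.inl (measure_ne_top _ _))
  have hle : ‖D K ij‖ₑ ≤ 0 := by
    have l3 := l1.add l2
    rw [add_zero] at l3
    refine ge_of_tendsto l3 ?_
    filter_upwards [self_mem_nhdsWithin] with δ hδ
    have hKU : K ⊆ U δ := Metric.self_subset_thickening hδ K
    have h1 : D K ij = D (U δ) ij - D (U δ \ K) ij := by
      rw [← VectorMeasure.of_add_of_sdiff hK.measurableSet (hUo δ).measurableSet hKU]
      simp
    rw [h1, sub_eq_add_neg, ← measure_sdiff hKU hK.measurableSet.nullMeasurableSet
      (measure_ne_top _ _)]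
    refine (enorm_add_le _ _).trans (add_le_add ?_ ?_)
    · rw [hD.apply_eq_setIntegral hG (hUo δ) (hUb δ), withDensity_apply _ (hUo δ).measurableSet]
      exact enorm_integral_le_lintegral_enorm _
    · rw [enorm_neg]
      refine le_trans ?_ (VectorMeasure.enorm_measure_le_variation _ _)
      rw [enorm_le_iff_norm_le]
      exact PiLp.norm_apply_le _ _
  simpa using hle

/-- If the distributional derivative of `f` is both a finite measure and a locally integrable
function, then the measure is absolutely continuous. -/
lemma IsDerivMeasure.variation_absolutelyContinuous {f : Eucl d → Eucl d}
    {D : VectorMeasure (Eucl d) (EuclMat d)} (hD : IsDerivMeasure f D) {G : Eucl d → EuclMat d}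
    (hG : IsWeakGrad f G) : D.variation ≪ volume := by
  have : IsFiniteMeasure D.variation := ⟨hD.1⟩
  refine Measure.AbsolutelyContinuous.mk fun A hA hA0 => ?_
  refine (D.variation_apply_eq_zero hA).2 fun B hBA hB => ?_
  rw [← enorm_eq_zero, ← nonpos_iff_eq_zero]
  refine ENNReal.le_of_forall_pos_le_add fun ε hε _ => ?_
  obtain ⟨K, hKB, hK, hKε⟩ := hB.exists_isCompact_sdiff_lt (measure_ne_top D.variation B)
    (ε := ε) (by exact_mod_cast hε.ne')
  refine (enorm_le_enorm_add_variation_diff D hK.measurableSet hB hKB).trans ?_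
  rw [hD.apply_eq_zero_of_isCompact hG hK (measure_mono_null (hKB.trans hBA) hA0), enorm_zero]
  gcongr

lemma derivVarSing_eq_zero_of_isWeakGrad {f : Eucl d → Eucl d}
    (hf : ∃ D, IsDerivMeasure f D) {G : Eucl d → EuclMat d} (hG : IsWeakGrad f G) :
    derivVarSing f = 0 :=
  (Measure.singularPart_eq_zero _ _).2
    ((isDerivMeasure_derivMeasure hf).variation_absolutelyContinuous hG)

/-- The gradient of the convolution of `f` with `ψ`. -/
noncomputable def mollifiedGrad (ψ : Eucl d → ℝ) (f : Eucl d → Eucl d) (x : Eucl d) : EuclMat d :=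
  WithLp.toLp 2 fun ij => ∫ y, f y ij.1 * partialDeriv ij.2 ψ (x - y)

lemma partialDeriv_comp_const_sub {ψ : Eucl d → ℝ} (hψ : IsTestFun ψ) (j : Fin d)
    (x y : Eucl d) : partialDeriv j (fun z => ψ (x - z)) y = -partialDeriv j ψ (x - y) := by
  have h1 : HasFDerivAt (fun z => ψ (x - z)) ((fderiv ℝ ψ (x - y)).comp
      (-ContinuousLinearMap.id ℝ (Eucl d))) y :=
    ((hψ.1.differentiable (by simp)) (x - y)).hasFDerivAt.comp y
      ((hasFDerivAt_id y).const_sub x)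
  simp [partialDeriv, h1.fderiv]

lemma IsTestFun.comp_const_sub {ψ : Eucl d → ℝ} (hψ : IsTestFun ψ) (x : Eucl d) :
    IsTestFun fun z => ψ (x - z) :=
  ⟨hψ.1.comp (contDiff_const.sub contDiff_id),
    hψ.2.comp_homeomorph (Homeomorph.subLeft x)⟩

/-- The left side involves only values of `f`, hence is measurable in parameters; the right side is
the convolution of `ψ` with `D`, hence approximates a density. -/
lemma mollifiedGrad_eq {f : Eucl d → Eucl d} {D : VectorMeasure (Eucl d) (EuclMat d)}
    (hD : IsDerivMeasure f D) {ψ : Eucl d → ℝ} (hψ : IsTestFun ψ) (x : Eucl d) :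
    mollifiedGrad ψ f x = ∫ᵛ y, ψ (x - y) ∂•D := by
  ext ij
  have h := hD.2 _ (hψ.comp_const_sub x) ij.1 ij.2
  simp_rw [partialDeriv_comp_const_sub hψ, mul_neg, integral_neg] at h
  exact neg_injective h

lemma stronglyMeasurable_mollifiedGrad {T : Type*} [MeasurableSpace T] {c : T → Eucl d → Eucl d}
    (hc : StronglyMeasurable fun p : T × Eucl d => c p.1 p.2) {ψ : Eucl d → ℝ}
    (hψ : IsTestFun ψ) :
    StronglyMeasurable fun p : T × Eucl d => mollifiedGrad ψ (c p.1) p.2 := by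
  refine Measurable.stronglyMeasurable ?_
  refine (WithLp.measurable_toLp 2 _).comp (measurable_pi_iff.2 fun ij => ?_)
  refine (StronglyMeasurable.integral_prod_right (f := fun (p : T × Eucl d) y =>
    c p.1 y ij.1 * partialDeriv ij.2 ψ (p.2 - y)) ?_).measurable
  refine StronglyMeasurable.mul ?_ ?_
  · exact (PiLp.continuous_apply 2 _ ij.1).comp_stronglyMeasurable
      (hc.comp_measurable (measurable_fst.fst.prodMk measurable_snd))
  · exact (hψ.continuous_partialDeriv ij.2).stronglyMeasurable.comp_measurable
      (measurable_fst.snd.sub measurable_snd)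

/-- A jointly measurable function whose slices are densities of the distributional derivatives,
whenever these are absolutely continuous. -/
lemma exists_measurable_weakGrad {T : Type*} [MeasurableSpace T] {c : T → Eucl d → Eucl d}
    (hc : StronglyMeasurable fun p : T × Eucl d => c p.1 p.2)
    (h : ∀ t, ∃ D, IsDerivMeasure (c t) D) :
    ∃ G : T → Eucl d → EuclMat d, StronglyMeasurable (fun p : T × Eucl d => G p.1 p.2) ∧
      ∀ t, derivVar (c t) ≪ volume → Integrable (G t) ∧
        ∫⁻ x, ‖G t x‖ₑ ≤ (d * d) * (2 * derivVar (c t) univ) ∧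
        ∀ φ : Eucl d → ℝ, IsTestFun φ → ∀ i j : Fin d,
          ∫ x, c t x i * partialDeriv j φ x = -∫ x, φ x * G t x (i, j) := by
  let β : ℕ → ContDiffBump (0 : Eucl d) := fun n =>
    ⟨1 / ((n : ℝ) + 1), 2 * (1 / ((n : ℝ) + 1)), Nat.one_div_pos_of_nat, by
      have : (0 : ℝ) < 1 / (n + 1) := Nat.one_div_pos_of_nat
      linarith⟩
  let ψ : ℕ → Eucl d → ℝ := fun n => (β n).normed volume
  have hψ : ∀ n, IsTestFun (ψ n) := fun n =>
    ⟨(β n).contDiff_normed, (β n).hasCompactSupport_normed⟩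
  -- Defined at all `(t, x)`, with a junk value where the limit does not exist; this keeps joint
  -- measurability without selecting densities for each `t`.
  refine ⟨fun t x => limUnder atTop fun n => mollifiedGrad (ψ n) (c t) x,
    StronglyMeasurable.limUnder (f := fun n (p : T × Eucl d) => mollifiedGrad (ψ n) (c p.1) p.2)
      fun n => stronglyMeasurable_mollifiedGrad hc (hψ n), fun t hac => ?_⟩
  have hD := isDerivMeasure_derivMeasure (h t)
  obtain ⟨g, hg, hgD, hgle⟩ := exists_density_of_absolutelyContinuous (derivMeasure (c t)) hac
  have hbound : ∀ φ : Eucl d → ℝ, IsTestFun φ →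
      ∫ᵛ x, φ x ∂•(derivMeasure (c t)) = ∫ x, φ x • g x := fun φ hφ => by
    obtain ⟨C, hC⟩ := hφ.2.exists_bound_of_continuous hφ.1.continuous
    exact vectorIntegral_eq_integral_smul_density hg hgD hφ.1.continuous.stronglyMeasurable hC
  -- Lebesgue differentiation: the bumps have outer radius twice the inner one, so mollifications of
  -- `g` converge to `g` almost everywhere.
  have hGg : (fun x => limUnder atTop fun n => mollifiedGrad (ψ n) (c t) x) =ᵐ[volume] g := by
    have hr : Tendsto (fun n => (β n).rOut) atTop (𝓝 0) := by
      simpa [β] using (tendsto_one_div_add_atTop_nhds_zero_nat (𝕜 := ℝ)).const_mul 2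
    filter_upwards [ContDiffBump.ae_convolution_tendsto_right_of_locallyIntegrable hr
      (K := 2) (Eventually.of_forall fun n => le_rfl) hg.locallyIntegrable] with x hx
    refine Tendsto.limUnder_eq (hx.congr fun n => ?_)
    rw [mollifiedGrad_eq hD (hψ n), hbound _ ((hψ n).comp_const_sub x), convolution_eq_swap]
    rfl
  refine ⟨hg.congr hGg.symm, ?_, fun φ hφ i j => ?_⟩
  · refine (lintegral_congr_ae (hGg.fun_comp fun v => ‖v‖ₑ)).trans_le ?_
    simpa [derivVar] using hgle
  · rw [hD.2 φ hφ i j, hbound φ hφ]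
    congr 1
    have hint : ∀ k, Integrable (fun x => (φ x • g x) k) := fun k => by
      obtain ⟨C, hC⟩ := hφ.2.exists_bound_of_continuous hφ.1.continuous
      exact Integrable.eval_piLp
        (hg.bdd_smul C hφ.1.continuous.aestronglyMeasurable (ae_of_all _ hC)) k
    rw [eval_integral_piLp hint]
    refine integral_congr_ae ?_
    filter_upwards [hGg] with x hx
    rw [hx]
    rfl

end WeakGradient

/-! ### Integration in time and the decay property. -/

section Decay

variable {d : ℕ}

/-- The contribution of a single time to `decayQ`. -/
noncomputable def decaySlice (μ : Measure (Eucl d)) (B : Set (Eucl d)) (δ : ℝ) : ℝ≥0∞ :=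
  (ENNReal.ofReal |Real.log δ|)⁻¹ *
    ∫⁻ x in B, min (ENNReal.ofReal δ⁻¹) (maximalFun μ x)

/-- The majorant, independent of small `δ`, for the reverse Fatou lemma. -/
lemma decaySlice_le (μ : Measure (Eucl d)) (B : Set (Eucl d)) {δ : ℝ} (hδ : δ ∈ Ioo (0 : ℝ) 1)
    (hL : 1 ≤ ENNReal.ofReal |Real.log δ|) :
    decaySlice μ B δ ≤ volume B + 4 ^ d * μ univ := by
  calc decaySlice μ B δ ≤ (ENNReal.ofReal |Real.log δ|)⁻¹ *
        (volume B + 4 ^ d * μ univ * ENNReal.ofReal |Real.log δ|) := by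
        rw [decaySlice]
        gcongr
        exact lintegral_min_maximalFun_le μ B hδ.1 hδ.2
    _ = (ENNReal.ofReal |Real.log δ|)⁻¹ * volume B + 4 ^ d * μ univ := by
        rw [mul_add, mul_comm (4 ^ d * μ univ), ← mul_assoc _ _ (4 ^ d * μ univ),
          ENNReal.inv_mul_cancel (ofReal_abs_log_ne_zero hδ) ENNReal.ofReal_ne_top, one_mul]
    _ ≤ _ := by
        gcongr
        exact mul_le_of_le_one_left' (ENNReal.inv_le_one.2 hL)

lemma measurable_lintegral_min_maximalFun {T : Type*} [MeasurableSpace T]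
    {κ : T → Measure (Eucl d)} (hκ : Measurable κ) (hfin : ∀ t, IsFiniteMeasure (κ t))
    (B : Set (Eucl d)) (δ : ℝ) :
    Measurable fun t => ∫⁻ x in B, min (ENNReal.ofReal δ⁻¹) (maximalFun (κ t) x) :=
  Measurable.lintegral_prod_right' (f := fun p : T × Eucl d =>
    min (ENNReal.ofReal δ⁻¹) (maximalFun (κ p.1) p.2))
    (measurable_const.min (measurable_maximalFun_prod hκ hfin))

lemma measurable_decaySlice {T : Type*} [MeasurableSpace T] {κ : T → Measure (Eucl d)}
    (hκ : Measurable κ) (hfin : ∀ t, IsFiniteMeasure (κ t)) (B : Set (Eucl d)) (δ : ℝ) :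
    Measurable fun t => decaySlice (κ t) B δ :=
  (measurable_lintegral_min_maximalFun hκ hfin B δ).const_mul _

lemma decayQ_eq_lintegral {T : ℝ≥0∞} {b c : ℝ → Eucl d → Eucl d}
    (hc : Measurable fun t => derivVar (c t))
    (hcb : ∀ᵐ t ∂(volume.restrict (timeInterval T)), derivVar (c t) = derivVar (b t))
    (B : Set (Eucl d)) (δ : ℝ) :
    decayQ T b B δ = ∫⁻ t in timeInterval T, decaySlice (derivVar (c t)) B δ := by
  have hfin : ∀ t, IsFiniteMeasure (derivVar (c t)) := fun t => inferInstance
  have hm := measurable_lintegral_min_maximalFun hc hfin B δ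
  have hcongr : ∫⁻ t in timeInterval T, ∫⁻ x in B,
      min (ENNReal.ofReal δ⁻¹) (maximalFun (derivVar (b t)) x) =
      ∫⁻ t in timeInterval T, ∫⁻ x in B,
        min (ENNReal.ofReal δ⁻¹) (maximalFun (derivVar (c t)) x) := by
    refine lintegral_congr_ae ?_
    filter_upwards [hcb] with t ht
    rw [ht]
  simp only [decayQ, decaySlice]
  rw [hcongr, lintegral_const_mul _ hm]

lemma volume_timeInterval_ne_top {T : ℝ≥0∞} (hT : T ≠ ∞) : volume (timeInterval T) ≠ ∞ := by
  refine ne_top_of_le_ne_top (b := volume (Ioo 0 T.toReal)) (by simp) (measure_mono fun t ht => ?_)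
  exact ⟨ht.1, (ENNReal.ofReal_lt_iff_lt_toReal ht.1.le hT).1 ht.2⟩

lemma MemL1BV.lintegral_derivVar_ne_top {T : ℝ≥0∞} {b : ℝ → Eucl d → Eucl d} (hb : MemL1BV T b) :
    ∫⁻ t in timeInterval T, derivVar (b t) univ ≠ ∞ :=
  ((lintegral_mono fun _ => le_add_self).trans_lt hb.2.2).ne

lemma lintegral_derivVarSing_ball_le {T : ℝ≥0∞} {b c : ℝ → Eucl d → Eucl d}
    (hc : Measurable fun t => derivVar (c t))
    (hcb : ∀ᵐ t ∂(volume.restrict (timeInterval T)), derivVar (c t) = derivVar (b t))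
    (x₀ : Eucl d) (r : ℝ) :
    ∫⁻ t in timeInterval T, derivVarSing (b t) (Metric.ball x₀ r) ≤
      2 * 15 ^ d * liminf (fun δ => decayQ T b (Metric.ball x₀ r) δ) (𝓝[>] (0 : ℝ)) := by
  simp_rw [decayQ_eq_lintegral hc hcb]
  calc ∫⁻ t in timeInterval T, derivVarSing (b t) (Metric.ball x₀ r)
      ≤ ∫⁻ t in timeInterval T, 2 * 15 ^ d *
          liminf (fun δ => decaySlice (derivVar (c t)) (Metric.ball x₀ r) δ) (𝓝[>] 0) := by
        refine lintegral_mono_ae ?_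
        filter_upwards [hcb] with t ht
        rw [derivVarSing, ← ht]
        exact singularPart_ball_le_liminf_truncated _ x₀ r
    _ = 2 * 15 ^ d * ∫⁻ t in timeInterval T,
          liminf (fun δ => decaySlice (derivVar (c t)) (Metric.ball x₀ r) δ) (𝓝[>] 0) :=
        lintegral_const_mul' _ _ (by finiteness)
    _ ≤ _ := by
        gcongr
        exact lintegral_liminf_le fun δ => measurable_decaySlice hc (fun t => inferInstance) _ δ

/-- Reverse Fatou applied to the slice estimate. Finiteness of `T` is what makes the constant
`volume B` in the majorant integrable in time. -/
lemma limsup_decayQ_le {T : ℝ≥0∞} (hT : T ≠ ∞) {b c : ℝ → Eucl d → Eucl d} (hb : MemL1BV T b)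
    (hc : Measurable fun t => derivVar (c t))
    (hcb : ∀ᵐ t ∂(volume.restrict (timeInterval T)), derivVar (c t) = derivVar (b t))
    (x₀ : Eucl d) (r : ℝ) :
    limsup (fun δ => decayQ T b (Metric.ball x₀ r) δ) (𝓝[>] (0 : ℝ)) ≤
      4 ^ d * ∫⁻ t in timeInterval T, derivVarSing (b t) (closure (Metric.ball x₀ r)) := by
  set B := Metric.ball x₀ r
  refine le_of_forall_lt fun a ha => ?_
  obtain ⟨a', haa', ha'⟩ := exists_between ha
  -- Any level below the upper limit is exceeded along a sequence of `δ`, to which reverse Fatou is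
  -- applied.
  have hfreq : ∃ᶠ δ in 𝓝[>] (0 : ℝ), a' < decayQ T b B δ := frequently_lt_of_lt_limsup (by isBoundedDefault) ha'
  have hev : ∀ᶠ δ in 𝓝[>] (0 : ℝ), δ ∈ Ioo (0 : ℝ) 1 ∧ 1 ≤ ENNReal.ofReal |Real.log δ| :=
    eventually_mem_Ioo_zero_one.and
      ((tendsto_ofReal_abs_log.eventually (lt_mem_nhds ENNReal.one_lt_top)).mono fun _ h => h.le)
  obtain ⟨δ, hδ, hδQ⟩ := exists_seq_forall_of_frequently (hfreq.and_eventually hev)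
  have hbound : ∀ n, (fun t => decaySlice (derivVar (c t)) B (δ n)) ≤ᵐ[volume.restrict
      (timeInterval T)] fun t => volume B + 4 ^ d * derivVar (c t) univ := fun n =>
    ae_of_all _ fun t => decaySlice_le _ B (hδQ n).2.1 (hδQ n).2.2
  have hfin : ∫⁻ t in timeInterval T, (volume B + 4 ^ d * derivVar (c t) univ) ≠ ∞ := by
    rw [lintegral_add_left measurable_const, setLIntegral_const,
      lintegral_const_mul' _ _ (by finiteness)]
    refine ENNReal.add_ne_top.2 ⟨ENNReal.mul_ne_top measure_ball_lt_top.ne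
      (volume_timeInterval_ne_top hT), ENNReal.mul_ne_top (by finiteness) ?_⟩
    rw [lintegral_congr_ae (g := fun t => derivVar (b t) univ)
      (by filter_upwards [hcb] with t ht; rw [ht])]
    exact hb.lintegral_derivVar_ne_top
  calc a < a' := haa'
    _ ≤ limsup (fun n => decayQ T b B (δ n)) atTop :=
        le_limsup_of_frequently_le (Eventually.of_forall fun n => (hδQ n).1.le).frequently
          (by isBoundedDefault)
    _ ≤ ∫⁻ t in timeInterval T, limsup (fun n => decaySlice (derivVar (c t)) B (δ n)) atTop := by
        simp_rw [decayQ_eq_lintegral hc hcb]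
        exact limsup_lintegral_le _
          (fun n => measurable_decaySlice hc (fun t => inferInstance) _ (δ n)) hbound hfin
    _ ≤ ∫⁻ t in timeInterval T, 4 ^ d * derivVarSing (b t) (closure B) := by
        refine lintegral_mono_ae ?_
        filter_upwards [hcb] with t ht
        refine (limsup_le_limsup_of_le (u := decaySlice (derivVar (c t)) B) hδ).trans ?_
        rw [derivVarSing, ← ht]
        exact limsup_truncated_le _ x₀ r
    _ = _ := lintegral_const_mul' _ _ (by finiteness)

lemma ae_derivVarSing_ball_eq_zero {T : ℝ≥0∞} {b c : ℝ → Eucl d → Eucl d}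
    (hc : Measurable fun t => derivVar (c t))
    (hcb : ∀ᵐ t ∂(volume.restrict (timeInterval T)), derivVar (c t) = derivVar (b t))
    (x₀ : Eucl d) (r : ℝ)
    (h : limsup (fun δ => decayQ T b (Metric.ball x₀ r) δ) (𝓝[>] (0 : ℝ)) = 0) :
    ∀ᵐ t ∂(volume.restrict (timeInterval T)), derivVarSing (c t) (Metric.ball x₀ r) = 0 := by
  -- Along a sequence the lower limit is measurable in `t`, so a zero integral makes it vanish
  -- almost everywhere.
  obtain ⟨δ, hδ⟩ := exists_seq_tendsto (𝓝[>] (0 : ℝ))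
  have hm : ∀ n, Measurable fun t => decaySlice (derivVar (c t)) (Metric.ball x₀ r) (δ n) :=
    fun n => measurable_decaySlice hc (fun t => inferInstance) _ (δ n)
  have h0 : ∫⁻ t in timeInterval T,
      liminf (fun n => decaySlice (derivVar (c t)) (Metric.ball x₀ r) (δ n)) atTop = 0 := by
    refine nonpos_iff_eq_zero.1 ((lintegral_liminf_le hm).trans ?_)
    simp_rw [← decayQ_eq_lintegral hc hcb, ← h]
    exact (liminf_le_limsup).trans
      (limsup_le_limsup_of_le (u := decayQ T b (Metric.ball x₀ r)) hδ)
  rw [lintegral_eq_zero_iff (Measurable.liminf hm)] at h0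
  filter_upwards [h0] with t ht
  refine nonpos_iff_eq_zero.1 ((singularPart_ball_le_liminf_truncated _ x₀ r).trans ?_)
  have hle : liminf (decaySlice (derivVar (c t)) (Metric.ball x₀ r)) (𝓝[>] 0) ≤
      liminf (fun n => decaySlice (derivVar (c t)) (Metric.ball x₀ r) (δ n)) atTop :=
    liminf_le_liminf_of_le (u := decaySlice (derivVar (c t)) (Metric.ball x₀ r)) hδ
  rw [ht] at hle
  exact (mul_le_mul_right hle _).trans (by simp)

lemma DecayProperty.memL1W11loc {T : ℝ≥0∞} {b c : ℝ → Eucl d → Eucl d} (hb : MemL1BV T b)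
    (hcm : StronglyMeasurable fun p : ℝ × Eucl d => c p.1 p.2)
    (hcD : ∀ t, ∃ D, IsDerivMeasure (c t) D)
    (hcb : ∀ᵐ t ∂(volume.restrict (timeInterval T)), c t =ᵐ[volume] b t)
    (h : DecayProperty T b) : MemL1W11loc T b := by
  have hcm' := measurable_derivVar hcm hcD
  have hcb' : ∀ᵐ t ∂(volume.restrict (timeInterval T)), derivVar (c t) = derivVar (b t) := by
    filter_upwards [hcb] with t ht
    rw [derivVar, derivMeasure_congr_ae ht, derivVar]
  have hac : ∀ᵐ t ∂(volume.restrict (timeInterval T)), derivVar (c t) ≪ volume := by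
    -- Countably many balls exhaust the space, so one null set of times suffices.
    have hn : ∀ᵐ t ∂(volume.restrict (timeInterval T)), ∀ n : ℕ,
        derivVarSing (c t) (Metric.ball 0 ((n : ℝ) + 1)) = 0 :=
      ae_all_iff.2 fun n => ae_derivVarSing_ball_eq_zero hcm' hcb' 0 _ (h 0 _ (by positivity))
    filter_upwards [hn] with t ht
    refine (Measure.singularPart_eq_zero _ _).1 (Measure.measure_univ_eq_zero.1 ?_)
    have hU : (univ : Set (Eucl d)) = ⋃ n : ℕ, Metric.ball 0 ((n : ℝ) + 1) := by
      refine (eq_univ_of_forall fun x => ?_).symm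
      obtain ⟨n, hn⟩ := exists_nat_ge ‖x‖
      exact mem_iUnion.2 ⟨n, by simpa using by linarith⟩
    rw [hU]
    exact measure_iUnion_null ht
  obtain ⟨G, hGm, hG⟩ := exists_measurable_weakGrad hcm hcD
  refine ⟨hb.1, G, hGm.aestronglyMeasurable, ?_, fun x₀ r hr => ?_⟩
  · filter_upwards [hac, hcb, hb.2.1] with t h1 h2 h3
    obtain ⟨hGi, -, hGt⟩ := hG t h1
    refine ⟨h3.1.locallyIntegrable, hGi.locallyIntegrable, fun φ hφ i j => ?_⟩
    rw [← hGt φ hφ i j]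
    refine integral_congr_ae ?_
    filter_upwards [h2] with x hx
    rw [hx]
  · calc ∫⁻ t in timeInterval T, ∫⁻ x in Metric.ball x₀ r, (‖b t x‖ₑ + ‖G t x‖ₑ)
        ≤ ∫⁻ t in timeInterval T, (1 + d * d * 2) *
            (eLpNorm (b t) 1 volume + derivVar (b t) univ) := by
          refine lintegral_mono_ae ?_
          filter_upwards [hac, hcb', hb.2.1] with t h1 h2 h3
          obtain ⟨hGi, hGle, -⟩ := hG t h1
          calc ∫⁻ x in Metric.ball x₀ r, (‖b t x‖ₑ + ‖G t x‖ₑ)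
              ≤ ∫⁻ x, (‖b t x‖ₑ + ‖G t x‖ₑ) := setLIntegral_le_lintegral _ _
            _ = eLpNorm (b t) 1 volume + ∫⁻ x, ‖G t x‖ₑ := by
                rw [lintegral_add_left' h3.1.1.enorm, eLpNorm_one_eq_lintegral_enorm]
            _ ≤ eLpNorm (b t) 1 volume + d * d * (2 * derivVar (b t) univ) := by
                rw [← h2]
                gcongr
            _ = 1 * eLpNorm (b t) 1 volume + d * d * 2 * derivVar (b t) univ := by
                rw [one_mul, ← mul_assoc (d * d : ℝ≥0∞)]
            _ ≤ (1 + d * d * 2) * eLpNorm (b t) 1 volume +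
                (1 + d * d * 2) * derivVar (b t) univ := by
                gcongr
                · exact le_self_add
                · exact le_add_self
            _ = _ := (mul_add _ _ _).symm
      _ = (1 + d * d * 2) * ∫⁻ t in timeInterval T,
            (eLpNorm (b t) 1 volume + derivVar (b t) univ) :=
          lintegral_const_mul' _ _ (by finiteness)
      _ < ∞ := ENNReal.mul_lt_top (by finiteness) hb.2.2

end Decay

theorem mainTheorem5 (d : ℕ) :
    ∃ C : ℝ≥0, 0 < C ∧
      ∀ (T : ℝ≥0∞), 0 < T → ∀ (b : ℝ → Eucl d → Eucl d),
        MemL1BV T b → DivMemL1Linfty T b →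
        (∀ (x₀ : Eucl d) (r : ℝ), 0 < r →
          (∫⁻ t in timeInterval T, derivVarSing (b t) (Metric.ball x₀ r) ≤
            C * liminf (fun δ => decayQ T b (Metric.ball x₀ r) δ) (𝓝[>] (0 : ℝ))) ∧
          (liminf (fun δ => decayQ T b (Metric.ball x₀ r) δ) (𝓝[>] (0 : ℝ)) ≤
            limsup (fun δ => decayQ T b (Metric.ball x₀ r) δ) (𝓝[>] (0 : ℝ))) ∧
          (T ≠ ∞ →
            limsup (fun δ => decayQ T b (Metric.ball x₀ r) δ) (𝓝[>] (0 : ℝ)) ≤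
              C * ∫⁻ t in timeInterval T,
                derivVarSing (b t) (closure (Metric.ball x₀ r)))) ∧
        (DecayProperty T b → MemL1W11loc T b) ∧
        (T ≠ ∞ → (DecayProperty T b ↔ MemL1W11loc T b)) := by
  -- The sum of the lower-bound constant `2 * 15 ^ d` and the upper-bound constant `4 ^ d` serves
  -- both.
  refine ⟨2 * 15 ^ d + 4 ^ d, by positivity, fun T _ b hb _ => ?_⟩
  obtain ⟨c, hcm, hcD, hcb⟩ := hb.exists_measurable_representative
  have hcm' := measurable_derivVar hcm hcD
  have hcb' : ∀ᵐ t ∂(volume.restrict (timeInterval T)), derivVar (c t) = derivVar (b t) := by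
    filter_upwards [hcb] with t ht
    rw [derivVar, derivMeasure_congr_ae ht, derivVar]
  have hW : DecayProperty T b → MemL1W11loc T b := fun h => h.memL1W11loc hb hcm hcD hcb
  refine ⟨fun x₀ r _ => ⟨?_, liminf_le_limsup, fun hT => ?_⟩, hW, fun hT => ⟨hW, ?_⟩⟩
  · refine (lintegral_derivVarSing_ball_le hcm' hcb' x₀ r).trans ?_
    gcongr
    push_cast
    exact le_self_add
  · refine (limsup_decayQ_le hT hb hcm' hcb' x₀ r).trans ?_
    gcongr
    push_cast
    exact le_add_self
  · rintro ⟨-, G, -, hG, -⟩ x₀ r _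
    refine nonpos_iff_eq_zero.1 ((limsup_decayQ_le hT hb hcm' hcb' x₀ r).trans ?_)
    rw [lintegral_congr_ae (g := fun _ => 0), lintegral_zero, mul_zero]
    filter_upwards [hG, hb.2.1] with t h1 h2
    rw [derivVarSing_eq_zero_of_isWeakGrad h2.2 h1]
    rfl
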